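/- Let $n,N\in\mathbb{N}$. Consider an $n$-qubit circuit built from the Clifford gates $S=\mathrm{diag}(1,i)$, $H$, CNOT, CZ and phase gates $Z(\alpha)=\exp(-i\frac{\alpha}{2}Z)$ with $\alpha\in\mathbb{R}$, and suppose that exactly $N$ of its phase gates are non-Clifford, i.e. have an angle $\alpha\notin\frac{\pi}{2}\mathbb{Z}$. For a set $S$ of qubits and $\alpha\in\mathbb{R}$, the targeted global Mølmer–Sørensen gate is $$\mathrm{GMS}_S(\alpha)=\exp\Bigl(-i\frac{\alpha}{4}\sum_{i,j\in S,\ i\neq j}X_iX_j\Bigr),$$ where $X_i$ is the Pauli $X$ operator on qubit $i$ and the sum is over ordered pairs. Then there is an $n$-qubit circuit, consisting only of single-qubit unitaries and targeted GMS gates (each with its own set of qubits and angle), that implements the same unitary, global phase included, and contains at most $\max(0,\,N+6n-8)$ GMS gates. In particular, for $n\ge 2$ it contains at most $N+6n-8$ GMS gates. -/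

import Mathlib

namespace GMSCircuit

/-- Operators on `n` qubits, as matrices in the computational basis; a basis state assigns
a bit to each qubit. -/
abbrev Op (n : ℕ) : Type := Matrix (Fin n → Fin 2) (Fin n → Fin 2) ℂ

/-- The single-qubit operator `U` applied to qubit `i`, with the identity on all other qubits. -/
def onQubit {n : ℕ} (i : Fin n) (U : Matrix (Fin 2) (Fin 2) ℂ) : Op n :=
  fun x y => if ∀ j, j ≠ i → x j = y j then U (x i) (y i) else 0

/-- The Pauli matrix `X`. -/
def pauliX : Matrix (Fin 2) (Fin 2) ℂ := !![0, 1; 1, 0]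

/-- The Hadamard matrix. -/
noncomputable def hadamard : Matrix (Fin 2) (Fin 2) ℂ :=
  ((Real.sqrt 2 : ℂ))⁻¹ • !![1, 1; 1, -1]

/-- The matrix of the `S` gate. -/
noncomputable def sMatrix : Matrix (Fin 2) (Fin 2) ℂ := !![1, 0; 0, Complex.I]

/-- The phase gate `Z(α) = exp(-i (α/2) Z)`, where `Z = diag(1, -1)`. -/
noncomputable def zPhase (α : ℝ) : Matrix (Fin 2) (Fin 2) ℂ :=
  !![Complex.exp (-Complex.I * (α / 2)), 0; 0, Complex.exp (Complex.I * (α / 2))]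

/-- The CNOT gate with control `c` and target `t`: it sends the basis state `y` to the basis
state in which bit `t` is replaced by the sum modulo 2 of bits `t` and `c` of `y`. -/
def cnotOp {n : ℕ} (c t : Fin n) : Op n :=
  fun x y => if x = Function.update y t (y t + y c) then 1 else 0

/-- The CZ gate on qubits `i` and `j`: the sign `-1` exactly on basis states where
both bits are `1`. -/
def czOp {n : ℕ} (i j : Fin n) : Op n :=
  Matrix.diagonal fun x => if x i = 1 ∧ x j = 1 then -1 else 1

/-- The targeted global Mølmer–Sørensen gate
`GMS_S(α) = exp(-i (α/4) ∑_{i ≠ j ∈ S} X_i X_j)`;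
the sum is over ordered pairs of distinct elements of `S`. -/
noncomputable def gmsOp {n : ℕ} (S : Finset (Fin n)) (α : ℝ) : Op n :=
  NormedSpace.exp
    ((-Complex.I * (α / 4)) • ∑ p ∈ S.offDiag, onQubit p.1 pauliX * onQubit p.2 pauliX)

/-- Gates of the Clifford+Phases gate set on `n` qubits. -/
inductive CPGate (n : ℕ) : Type
  | s (i : Fin n) : CPGate n
  | h (i : Fin n) : CPGate n
  | cnot (c t : Fin n) (hct : c ≠ t) : CPGate n
  | cz (i j : Fin n) (hij : i ≠ j) : CPGate n
  | phase (i : Fin n) (α : ℝ) : CPGate n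

/-- The unitary implemented by a Clifford+Phases gate. -/
noncomputable def CPGate.toOp {n : ℕ} : CPGate n → Op n
  | .s i => onQubit i sMatrix
  | .h i => onQubit i hadamard
  | .cnot c t _ => cnotOp c t
  | .cz i j _ => czOp i j
  | .phase i α => onQubit i (zPhase α)

/-- A gate is a non-Clifford phase if it is `Z(α)` with `α` not an integer multiple of `π/2`. -/
def CPGate.IsNonClifford {n : ℕ} : CPGate n → Prop
  | .phase _ α => ∀ k : ℤ, α ≠ k * (Real.pi / 2)
  | _ => False

/-- Gates of the target gate set on `n` qubits: arbitrary single-qubit unitaries, and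
GMS gates on any subset of the qubits with any interaction angle. -/
inductive GMSGate (n : ℕ) : Type
  | single (i : Fin n) (U : Matrix.unitaryGroup (Fin 2) ℂ) : GMSGate n
  | gms (S : Finset (Fin n)) (α : ℝ) : GMSGate n

/-- The unitary implemented by a gate of the target gate set. -/
noncomputable def GMSGate.toOp {n : ℕ} : GMSGate n → Op n
  | .single i U => onQubit i (U : Matrix (Fin 2) (Fin 2) ℂ)
  | .gms S α => gmsOp S α

/-- Whether a gate of the target gate set is a GMS gate. -/
def GMSGate.isGMS {n : ℕ} : GMSGate n → Bool
  | .single _ _ => false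
  | .gms _ _ => true

/-- The operator implemented by a list of gates, whose head is applied first. -/
def evalCircuit {n : ℕ} {G : Type} (toOp : G → Op n) : List G → Op n
  | [] => 1
  | g :: c => evalCircuit toOp c * toOp g

open Classical in
/-- The number of non-Clifford phase gates in a Clifford+Phases circuit. -/
noncomputable def nonCliffordCount {n : ℕ} (c : List (CPGate n)) : ℕ :=
  c.countP fun g => decide g.IsNonClifford

/-- The number of GMS gates in a circuit over the target gate set. -/
def gmsCount {n : ℕ} (c : List (GMSGate n)) : ℕ := c.countP GMSGate.isGMS

end GMSCircuit

namespace GMSCircuit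

open Matrix

/-! ### Tensor products of single-qubit operators -/

/-! The circuit is read as `W * C` with `C` Clifford, and each non-Clifford phase is charged one GMS
gate. If `C` meets a phase gate on qubit `i`, then `C Z_i = M C` for a Pauli string `M`. A Clifford
`V` with `V M = Z_q V` gives `C Z_i(α) = V* Z_q(α) (V C)`. Only `V*` has to be implemented; `V`
disappears into the Clifford part (`exists_isImpl_mul_isClifford`).

One GMS gate is enough for `V*`. Conjugated by Hadamards, a GMS gate becomes a diagonal Ising gate,
and at angle `-π/2` this gate exchanges, up to scalars, `X_q` with a string that has `X` or `Y` at
`q` and `Z` on the rest of `S`. Local Cliffords, which are free, bring any string with support `S`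
to that form (`exists_reduce_tens`).

The final Clifford is undone qubit by qubit with three GMS gates each
(`IsClifford.exists_fix_qubit`): one brings `q` into the support of the image of `Z_q`, one turns
this image into `Z_q`, and one turns the image of `X_q` into `X_q` while keeping `Z_q`. Once a
single qubit is left the operator is a one-qubit unitary, which also absorbs the global phase. The
total is `N + 3(n-1)`, which is at most `N + 6n - 8` for `n ≥ 2`; smaller `n` need no GMS gate. -/

/-- The tensor product of a family of single-qubit operators. -/
def tens {n : ℕ} (A : Fin n → Matrix (Fin 2) (Fin 2) ℂ) : Op n :=
  fun x y => ∏ j, A j (x j) (y j)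

theorem tens_mul {n : ℕ} (A B : Fin n → Matrix (Fin 2) (Fin 2) ℂ) :
    tens A * tens B = tens (A * B) := by
  ext x y
  simp only [tens, Matrix.mul_apply, Pi.mul_apply]
  rw [Finset.prod_univ_sum, Fintype.piFinset_univ]
  simp [Finset.prod_mul_distrib]

theorem tens_smul {n : ℕ} (c : Fin n → ℂ) (A : Fin n → Matrix (Fin 2) (Fin 2) ℂ) :
    tens (fun i => c i • A i) = (∏ i, c i) • tens A := by
  ext x y
  simp [tens, Finset.prod_mul_distrib]

theorem star_tens {n : ℕ} (A : Fin n → Matrix (Fin 2) (Fin 2) ℂ) :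
    star (tens A) = tens (star A) := by
  ext x y
  simp [tens, Matrix.star_apply, star_prod]

theorem onQubit_eq_tens {n : ℕ} (i : Fin n) (U : Matrix (Fin 2) (Fin 2) ℂ) :
    onQubit i U = tens (Function.update 1 i U) := by
  ext x y
  simp only [onQubit, tens]
  rw [← Finset.mul_prod_erase _ _ (Finset.mem_univ i), Function.update_self]
  split_ifs with h
  · rw [Finset.prod_eq_one, mul_one]
    intro j hj
    have hj := Finset.ne_of_mem_erase hj
    simp [Function.update_of_ne hj, h j hj]
  · push Not at h
    obtain ⟨j, hj, hxy⟩ := h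
    rw [Finset.prod_eq_zero (Finset.mem_erase.2 ⟨hj, Finset.mem_univ j⟩), mul_zero]
    simp [Function.update_of_ne hj, hxy]

theorem onQubit_one {n : ℕ} (i : Fin n) : onQubit i 1 = 1 := by
  ext x y
  by_cases h : x = y
  · subst h
    simp [onQubit]
  · rw [Matrix.one_apply_ne h, onQubit, ite_eq_right_iff]
    intro h1
    refine Matrix.one_apply_ne fun h2 => h (funext fun j => ?_)
    by_cases hj : j = i
    · rw [hj, h2]
    · exact h1 j hj

theorem onQubit_mul {n : ℕ} (i : Fin n) (U V : Matrix (Fin 2) (Fin 2) ℂ) :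
    onQubit i U * onQubit i V = onQubit i (U * V) := by
  simp only [onQubit_eq_tens, tens_mul, ← Function.update_mul, one_mul]

theorem tens_one {n : ℕ} : tens (1 : Fin n → Matrix (Fin 2) (Fin 2) ℂ) = 1 := by
  ext x y
  by_cases h : x = y
  · subst h
    simp [tens]
  · obtain ⟨j, hj⟩ := Function.ne_iff.1 h
    rw [Matrix.one_apply_ne h, tens, Finset.prod_eq_zero (Finset.mem_univ j)]
    simp [hj]

theorem star_onQubit {n : ℕ} (i : Fin n) (U : Matrix (Fin 2) (Fin 2) ℂ) :
    star (onQubit i U) = onQubit i (star U) := by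
  ext x y
  simp only [Matrix.star_apply, onQubit, eq_comm, apply_ite star, star_zero]

theorem onQubit_smul {n : ℕ} (i : Fin n) (c : ℂ) (U : Matrix (Fin 2) (Fin 2) ℂ) :
    onQubit i (c • U) = c • onQubit i U := by
  ext x y
  simp [onQubit]

theorem onQubit_add {n : ℕ} (i : Fin n) (U V : Matrix (Fin 2) (Fin 2) ℂ) :
    onQubit i (U + V) = onQubit i U + onQubit i V := by
  ext x y
  simp only [onQubit, Matrix.add_apply]
  split_ifs <;> simp

/-- A multiplicative property of all factors holds for their tensor product. -/
theorem tens_induction {n : ℕ} {p : Op n → Prop} (one : p 1)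
    (mul : ∀ A B, p A → p B → p (A * B)) (u : Fin n → Matrix (Fin 2) (Fin 2) ℂ)
    (h : ∀ i, p (onQubit i (u i))) : p (tens u) := by
  -- The factors are switched on one qubit at a time, the others being kept at the identity.
  have key : ∀ s : Finset (Fin n), p (tens fun i => if i ∈ s then u i else 1) := by
    intro s
    induction s using Finset.induction_on with
    | empty => simpa [← tens_one, Pi.one_def] using one
    | insert a s ha ih =>
      convert mul _ _ (h a) ih using 1
      rw [onQubit_eq_tens, tens_mul]
      congr 1
      funext i
      by_cases hi : i = a
      · subst hi; simp [ha]
      · simp [hi]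
  simpa using key Finset.univ

/-! ### Monomial operators -/

/-- The operator sending the basis state `y` to `φ y` times the basis state `π y`. -/
def mono {n : ℕ} (π : (Fin n → Fin 2) → (Fin n → Fin 2)) (φ : (Fin n → Fin 2) → ℂ) : Op n :=
  fun x y => if x = π y then φ y else 0

theorem mono_mul {n : ℕ} (π ρ : (Fin n → Fin 2) → (Fin n → Fin 2))
    (φ ψ : (Fin n → Fin 2) → ℂ) :
    mono π φ * mono ρ ψ = mono (fun y => π (ρ y)) (fun y => φ (ρ y) * ψ y) := by
  ext x y
  simp [mono, Matrix.mul_apply]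

theorem smul_mono {n : ℕ} (c : ℂ) (π : (Fin n → Fin 2) → (Fin n → Fin 2))
    (φ : (Fin n → Fin 2) → ℂ) : c • mono π φ = mono π (fun y => c * φ y) := by
  ext x y
  simp [mono]

theorem mono_id_one {n : ℕ} : mono (fun y : Fin n → Fin 2 => y) (fun _ => 1) = 1 := by
  ext x y
  simp [mono, Matrix.one_apply]

theorem mono_mem_unitary {n : ℕ} {π : (Fin n → Fin 2) → (Fin n → Fin 2)}
    {φ : (Fin n → Fin 2) → ℂ} (hπ : Function.Involutive π) (hφ : ∀ y, star (φ y) * φ y = 1) :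
    mono π φ ∈ unitary (Op n) := by
  refine Matrix.mem_unitaryGroup_iff'.2 ?_
  have : star (mono π φ) = mono π fun y => star (φ (π y)) := by
    ext x y
    simp only [mono, Matrix.star_apply]
    by_cases h : y = π x
    · have h' : x = π y := by rw [h, hπ]
      simp [if_pos h, ← h']
    · have h' : x ≠ π y := fun h' => h (by rw [h', hπ])
      simp [h, h']
  rw [this, mono_mul, ← mono_id_one]
  simp only [hπ _, hφ]

/-- The computational basis sign of qubit `i`. -/
def zSign {n : ℕ} (i : Fin n) (y : Fin n → Fin 2) : ℂ := if y i = 0 then 1 else -1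

/-- Flip the bit of qubit `i`. -/
def flipBit {n : ℕ} (i : Fin n) (y : Fin n → Fin 2) : Fin n → Fin 2 :=
  Function.update y i (y i + 1)

/-- The Pauli matrix `Y`. -/
def pauliY : Matrix (Fin 2) (Fin 2) ℂ := !![0, -Complex.I; Complex.I, 0]

/-- The Pauli matrix `Z`. -/
def pauliZ : Matrix (Fin 2) (Fin 2) ℂ := !![1, 0; 0, -1]

theorem flipBit_involutive {n : ℕ} (i : Fin n) : Function.Involutive (flipBit i) := by
  intro y
  funext j
  by_cases h : j = i
  · subst h
    simp only [flipBit, Function.update_self]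
    generalize y j = a
    fin_cases a <;> rfl
  · simp [flipBit, h]

theorem zSign_mul_self {n : ℕ} (i : Fin n) (y : Fin n → Fin 2) :
    zSign i y * zSign i y = 1 := by
  unfold zSign; split_ifs <;> norm_num

theorem zSign_flipBit_self {n : ℕ} (i : Fin n) (y : Fin n → Fin 2) :
    zSign i (flipBit i y) = -zSign i y := by
  simp only [zSign, flipBit, Function.update_self]
  generalize y i = a
  fin_cases a <;> simp

theorem zSign_flipBit_of_ne {n : ℕ} {i j : Fin n} (h : j ≠ i) (y : Fin n → Fin 2) :
    zSign j (flipBit i y) = zSign j y := by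
  simp [zSign, flipBit, h]

theorem onQubit_pauliX {n : ℕ} (i : Fin n) :
    onQubit i pauliX = mono (flipBit i) (fun _ => 1) := by
  ext x y
  simp only [onQubit, mono]
  by_cases h : ∀ j, j ≠ i → x j = y j
  · have : x = flipBit i y ↔ x i = y i + 1 := by
      constructor
      · intro h; simp [h, flipBit]
      · intro h'
        funext j
        by_cases hj : j = i
        · subst hj; simp [flipBit, h']
        · simp [flipBit, hj, h j hj]
    simp only [if_pos h, this]
    generalize x i = a
    generalize y i = b
    fin_cases a <;> fin_cases b <;> simp [pauliX]
  · rw [if_neg h, if_neg]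
    rintro rfl
    exact h fun j hj => by simp [flipBit, hj]

theorem onQubit_pauliZ {n : ℕ} (i : Fin n) :
    onQubit i pauliZ = mono (fun y => y) (zSign i) := by
  ext x y
  simp only [onQubit, mono]
  by_cases h : x = y
  · subst h
    simp only [zSign]
    generalize x i = a
    fin_cases a <;> simp [pauliZ]
  · rw [if_neg h, ite_eq_right_iff]
    intro h'
    have hi : x i ≠ y i := fun hi => h (funext fun j =>
      if hj : j = i then hj ▸ hi else h' j hj)
    revert hi
    generalize x i = a
    generalize y i = b
    fin_cases a <;> fin_cases b <;> simp [pauliZ]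

theorem czOp_eq_mono {n : ℕ} (i j : Fin n) :
    czOp i j = mono (fun y => y) (fun y => if y i = 1 ∧ y j = 1 then -1 else 1) := by
  ext x y
  by_cases h : x = y
  · subst h; simp [czOp, mono]
  · simp [czOp, mono, h]

theorem cnotOp_eq_mono {n : ℕ} (c t : Fin n) :
    cnotOp c t = mono (fun y => Function.update y t (y t + y c)) (fun _ => 1) := rfl

/-! ### Pauli operators -/

/-- Labels of the single-qubit Pauli matrices. -/
inductive Pauli : Type
  | I | X | Y | Z

/-- The matrix of a Pauli label. -/
def Pauli.mat : Pauli → Matrix (Fin 2) (Fin 2) ℂ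
  | .I => 1
  | .X => pauliX
  | .Y => pauliY
  | .Z => pauliZ

open Pauli

theorem Pauli.mat_mul_self (a : Pauli) : a.mat * a.mat = 1 := by
  cases a <;> ext i j <;> fin_cases i <;> fin_cases j <;>
    simp [mat, pauliX, pauliY, pauliZ, Matrix.mul_apply]

theorem Pauli.star_mat (a : Pauli) : star a.mat = a.mat := by
  cases a <;> ext i j <;> fin_cases i <;> fin_cases j <;>
    simp [mat, pauliX, pauliY, pauliZ, Matrix.star_apply]

theorem pauliX_mul_pauliZ : pauliX * pauliZ = -(pauliZ * pauliX) := by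
  ext i j; fin_cases i <;> fin_cases j <;> simp [pauliX, pauliZ, Matrix.mul_apply]

theorem pauliX_mul_pauliY : pauliX * pauliY = Complex.I • pauliZ := by
  ext i j; fin_cases i <;> fin_cases j <;> simp [pauliX, pauliY, pauliZ, Matrix.mul_apply]

theorem pauliY_mul_pauliX : pauliY * pauliX = (-Complex.I) • pauliZ := by
  ext i j; fin_cases i <;> fin_cases j <;> simp [pauliX, pauliY, pauliZ, Matrix.mul_apply]

theorem pauliY_mul_pauliZ : pauliY * pauliZ = Complex.I • pauliX := by
  ext i j; fin_cases i <;> fin_cases j <;> simp [pauliX, pauliY, pauliZ, Matrix.mul_apply]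

theorem pauliZ_mul_pauliY : pauliZ * pauliY = (-Complex.I) • pauliX := by
  ext i j; fin_cases i <;> fin_cases j <;> simp [pauliX, pauliY, pauliZ, Matrix.mul_apply]

theorem pauliZ_mul_pauliX : pauliZ * pauliX = Complex.I • pauliY := by
  ext i j; fin_cases i <;> fin_cases j <;> simp [pauliX, pauliY, pauliZ, Matrix.mul_apply]

theorem pauliX_mul_pauliZ' : pauliX * pauliZ = (-Complex.I) • pauliY := by
  ext i j; fin_cases i <;> fin_cases j <;> simp [pauliX, pauliY, pauliZ, Matrix.mul_apply]

/-- Phases are recorded only as nonzero scalars. The signs that matter later are recovered from the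
condition that a string squares to the identity. -/
theorem Pauli.exists_mat_mul (a b : Pauli) :
    ∃ (c : Pauli) (k : ℂ), k ≠ 0 ∧ a.mat * b.mat = k • c.mat := by
  have h1 := Complex.I_ne_zero
  have h2 := neg_ne_zero.2 Complex.I_ne_zero
  cases a <;> cases b
  · exact ⟨I, 1, one_ne_zero, by simp [mat]⟩
  · exact ⟨X, 1, one_ne_zero, by simp [mat]⟩
  · exact ⟨Y, 1, one_ne_zero, by simp [mat]⟩
  · exact ⟨Z, 1, one_ne_zero, by simp [mat]⟩
  · exact ⟨X, 1, one_ne_zero, by simp [mat]⟩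
  · exact ⟨I, 1, one_ne_zero, by rw [mat_mul_self, one_smul]; rfl⟩
  · exact ⟨Z, _, h1, pauliX_mul_pauliY⟩
  · exact ⟨Y, _, h2, pauliX_mul_pauliZ'⟩
  · exact ⟨Y, 1, one_ne_zero, by simp [mat]⟩
  · exact ⟨Z, _, h2, pauliY_mul_pauliX⟩
  · exact ⟨I, 1, one_ne_zero, by rw [mat_mul_self, one_smul]; rfl⟩
  · exact ⟨X, _, h1, pauliY_mul_pauliZ⟩
  · exact ⟨Z, 1, one_ne_zero, by simp [mat]⟩
  · exact ⟨Y, _, h1, pauliZ_mul_pauliX⟩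
  · exact ⟨X, _, h2, pauliZ_mul_pauliY⟩
  · exact ⟨I, 1, one_ne_zero, by rw [mat_mul_self, one_smul]; rfl⟩

/-- Distinct non-identity Pauli matrices anticommute. -/
theorem Pauli.mat_mul_comm_neg {a b : Pauli} (ha : a ≠ I) (hb : b ≠ I) (hab : a ≠ b) :
    a.mat * b.mat = -(b.mat * a.mat) := by
  cases a <;> cases b <;> first | exact absurd rfl ‹_› | skip
  all_goals
    simp [mat, pauliX_mul_pauliY, pauliY_mul_pauliX, pauliY_mul_pauliZ, pauliZ_mul_pauliY,
      pauliZ_mul_pauliX, pauliX_mul_pauliZ']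

theorem Pauli.mat_mul_comm_or (a b : Pauli) :
    a.mat * b.mat = b.mat * a.mat ∨ a.mat * b.mat = -(b.mat * a.mat) := by
  by_cases ha : a = I
  · subst ha; left; simp [mat]
  by_cases hb : b = I
  · subst hb; left; simp [mat]
  by_cases hab : a = b
  · subst hab; left; rfl
  · exact Or.inr (mat_mul_comm_neg ha hb hab)

/-- The Pauli strings, up to a nonzero scalar. -/
def IsPauli {n : ℕ} (M : Op n) : Prop :=
  ∃ (f : Fin n → Pauli) (c : ℂ), c ≠ 0 ∧ M = c • tens fun i => (f i).mat

theorem IsPauli.mul {n : ℕ} {M N : Op n} (hM : IsPauli M) (hN : IsPauli N) :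
    IsPauli (M * N) := by
  obtain ⟨f, c, hc, rfl⟩ := hM
  obtain ⟨g, d, hd, rfl⟩ := hN
  choose h k hk hfg using fun i => (f i).exists_mat_mul (g i)
  refine ⟨h, c * d * ∏ i, k i,
    mul_ne_zero (mul_ne_zero hc hd) (Finset.prod_ne_zero_iff.2 fun i _ => hk i), ?_⟩
  rw [smul_mul_smul_comm, tens_mul, mul_smul (c * d), ← tens_smul]
  congr 2
  exact funext hfg

theorem IsPauli.smul {n : ℕ} {M : Op n} {k : ℂ} (hk : k ≠ 0) (hM : IsPauli M) :
    IsPauli (k • M) := by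
  obtain ⟨f, c, hc, rfl⟩ := hM
  exact ⟨f, k * c, mul_ne_zero hk hc, smul_smul _ _ _⟩

theorem onQubit_mat_eq_tens {n : ℕ} (i : Fin n) (a : Pauli) :
    onQubit i a.mat = tens fun j => (Function.update (fun _ => I) i a j).mat := by
  rw [onQubit_eq_tens]
  congr 1
  funext j
  by_cases h : j = i
  · subst h; simp
  · simp [h, mat]

theorem isPauli_onQubit {n : ℕ} (i : Fin n) (a : Pauli) : IsPauli (onQubit i a.mat) :=
  ⟨_, 1, one_ne_zero, by rw [one_smul]; exact onQubit_mat_eq_tens i a⟩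

theorem isPauli_one {n : ℕ} : IsPauli (1 : Op n) :=
  ⟨fun _ => I, 1, one_ne_zero, by rw [one_smul]; exact tens_one.symm⟩

theorem isPauli_tens {n : ℕ} (f : Fin n → Pauli) : IsPauli (tens fun i => (f i).mat) :=
  ⟨f, 1, one_ne_zero, (one_smul _ _).symm⟩

theorem commute_onQubit_tens {n : ℕ} {i : Fin n} {U : Matrix (Fin 2) (Fin 2) ℂ}
    {A : Fin n → Matrix (Fin 2) (Fin 2) ℂ} (h : Commute U (A i)) :
    Commute (onQubit i U) (tens A) := by
  rw [Commute, SemiconjBy, onQubit_eq_tens, tens_mul, tens_mul]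
  congr 1
  funext j
  by_cases hj : j = i
  · subst hj; simpa using h.eq
  · simp [hj]

theorem commute_onQubit {n : ℕ} {i j : Fin n} (hij : i ≠ j) (U V : Matrix (Fin 2) (Fin 2) ℂ) :
    Commute (onQubit i U) (onQubit j V) := by
  rw [onQubit_eq_tens j]
  exact commute_onQubit_tens (by simp [hij])

theorem onQubit_mul_tens_neg {n : ℕ} {i : Fin n} {U : Matrix (Fin 2) (Fin 2) ℂ}
    {A : Fin n → Matrix (Fin 2) (Fin 2) ℂ} (h : U * A i = -(A i * U)) :
    onQubit i U * tens A = -(tens A * onQubit i U) := by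
  rw [onQubit_eq_tens, tens_mul, tens_mul, ← neg_one_smul ℂ]
  -- The global sign is placed on factor `i` alone, so that the claim can be checked factor by
  -- factor.
  have := tens_smul (fun j => if j = i then (-1 : ℂ) else 1) 
    (A * (Function.update 1 i U : Fin n → Matrix (Fin 2) (Fin 2) ℂ))
  rw [Finset.prod_ite_eq' Finset.univ i fun _ => (-1 : ℂ), if_pos (Finset.mem_univ i)] at this
  rw [← this]
  congr 1
  funext j
  by_cases hj : j = i
  · subst hj; simpa using h
  · simp [hj]

theorem tens_pauli_mul_self {n : ℕ} (f : Fin n → Pauli) :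
    (tens fun i => (f i).mat) * (tens fun i => (f i).mat) = 1 := by
  rw [tens_mul, ← tens_one]
  congr 1
  exact funext fun i => mat_mul_self _

theorem onQubit_mat_mul_self {n : ℕ} (i : Fin n) (a : Pauli) :
    onQubit i a.mat * onQubit i a.mat = 1 := by
  rw [onQubit_mul, mat_mul_self, onQubit_one]

theorem IsPauli.ne_zero {n : ℕ} {M : Op n} (hM : IsPauli M) : M ≠ 0 := by
  obtain ⟨f, c, hc, rfl⟩ := hM
  refine smul_ne_zero hc fun h => ?_
  have := tens_pauli_mul_self f
  rw [h, mul_zero] at this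
  exact zero_ne_one this

/-- Whether two operators commute with the Pauli operators `X` and `Z` of a qubit. -/
def FixesQubit {n : ℕ} (M : Op n) (i : Fin n) : Prop :=
  Commute M (onQubit i pauliX) ∧ Commute M (onQubit i pauliZ)

theorem FixesQubit.mul {n : ℕ} {M N : Op n} {i : Fin n} (hM : FixesQubit M i)
    (hN : FixesQubit N i) : FixesQubit (M * N) i :=
  ⟨hM.1.mul_left hN.1, hM.2.mul_left hN.2⟩

theorem fixesQubit_tens {n : ℕ} {A : Fin n → Matrix (Fin 2) (Fin 2) ℂ} {i : Fin n}
    (h : A i = 1) : FixesQubit (tens A) i :=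
  ⟨(commute_onQubit_tens (by simp [h])).symm, (commute_onQubit_tens (by simp [h])).symm⟩

theorem fixesQubit_onQubit {n : ℕ} {i j : Fin n} (hij : i ≠ j)
    (U : Matrix (Fin 2) (Fin 2) ℂ) : FixesQubit (onQubit i U) j :=
  ⟨commute_onQubit hij _ _, commute_onQubit hij _ _⟩

/-- Both relations together give `M N = -M N`, and `N` is invertible. Applied to nonzero Pauli
strings, this is the standard source of contradictions below. -/
theorem eq_zero_of_commute_of_anticommute {n : ℕ} {M N : Op n} (hN : N * N = 1)
    (h1 : Commute N M) (h2 : N * M = -(M * N)) : M = 0 := by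
  have h3 : M * N = 0 := by
    have h : M * N = -(M * N) := h1.eq.symm.trans h2
    ext x y
    exact self_eq_neg.1 (congrFun (congrFun h x) y)
  rw [← mul_one M, ← hN, ← mul_assoc, h3, zero_mul]

/-- A non-identity Pauli matrix anticommutes with at least one of `X` and `Z`. Thus `FixesQubit`
describes the support of a string without its labels, and it also makes sense for Clifford
operators. -/
theorem fixesQubit_pauli_iff {n : ℕ} {f : Fin n → Pauli} {c : ℂ} (hc : c ≠ 0) {i : Fin n} :
    FixesQubit (c • tens fun i => (f i).mat) i ↔ f i = I := by
  constructor
  · rintro ⟨hX, hZ⟩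
    by_contra h
    have key : ∀ a : Pauli, a ≠ I → a ≠ f i →
        ¬ Commute (c • tens fun i => (f i).mat) (onQubit i a.mat) := by
      intro a ha hf hcomm
      have h0 := eq_zero_of_commute_of_anticommute (onQubit_mat_mul_self i a) hcomm.symm
        (by rw [mul_smul_comm, onQubit_mul_tens_neg (mat_mul_comm_neg ha h hf),
              smul_mul_assoc, smul_neg])
      exact IsPauli.ne_zero ⟨f, c, hc, rfl⟩ h0
    by_cases hfX : f i = X
    · exact key Z (by simp) (by simp [hfX]) hZ
    · exact key X (by simp) (fun h => hfX h.symm) hX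
  · intro h
    have := fixesQubit_tens (A := fun i => (f i).mat) (i := i) (by simp [h, mat])
    exact ⟨this.1.smul_left c, this.2.smul_left c⟩

/-- A Pauli string commuting with all Pauli operators is a scalar. -/
theorem IsPauli.eq_smul_one {n : ℕ} {M : Op n} (hM : IsPauli M) (h : ∀ i, FixesQubit M i) :
    ∃ c : ℂ, M = c • 1 := by
  obtain ⟨f, c, hc, rfl⟩ := hM
  refine ⟨c, ?_⟩
  rw [← tens_one]
  congr 2
  funext i
  simp [(fixesQubit_pauli_iff hc).1 (h i), mat]

/-! ### Clifford operators -/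

/-- The unitaries that map Pauli strings to Pauli strings (up to scalars) by conjugation. -/
def IsClifford {n : ℕ} (C : Op n) : Prop :=
  C ∈ unitary (Op n) ∧ ∀ M, IsPauli M → ∃ M', IsPauli M' ∧ C * M = M' * C

theorem IsClifford.mul {n : ℕ} {C D : Op n} (hC : IsClifford C) (hD : IsClifford D) :
    IsClifford (C * D) := by
  refine ⟨mul_mem hC.1 hD.1, fun M hM => ?_⟩
  obtain ⟨M', hM', h⟩ := hD.2 M hM
  obtain ⟨M'', hM'', h'⟩ := hC.2 M' hM'
  exact ⟨M'', hM'', by rw [mul_assoc, h, ← mul_assoc, h', mul_assoc]⟩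

theorem isClifford_one {n : ℕ} : IsClifford (1 : Op n) :=
  ⟨one_mem _, fun M hM => ⟨M, hM, by simp⟩⟩

/-- Being conjugated to a Pauli string is stable under products and nonzero scalars, and `Y = -i Z
X`, so the operators `X_i` and `Z_i` suffice. -/
theorem isClifford_of_generators {n : ℕ} {C : Op n} (hC : C ∈ unitary (Op n))
    (hX : ∀ i, ∃ M', IsPauli M' ∧ C * onQubit i pauliX = M' * C)
    (hZ : ∀ i, ∃ M', IsPauli M' ∧ C * onQubit i pauliZ = M' * C) : IsClifford C := by
  refine ⟨hC, ?_⟩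
  rintro M ⟨f, c, hc, rfl⟩
  have mul : ∀ A B : Op n, (∃ M', IsPauli M' ∧ C * A = M' * C) →
      (∃ M', IsPauli M' ∧ C * B = M' * C) → ∃ M', IsPauli M' ∧ C * (A * B) = M' * C := by
    rintro A B ⟨A', hA', hA⟩ ⟨B', hB', hB⟩
    exact ⟨A' * B', hA'.mul hB', by rw [← mul_assoc, hA, mul_assoc, hB, mul_assoc]⟩
  have smul : ∀ (k : ℂ) (A : Op n), k ≠ 0 → (∃ M', IsPauli M' ∧ C * A = M' * C) →
      ∃ M', IsPauli M' ∧ C * (k • A) = M' * C := by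
    rintro k A hk ⟨A', hA', hA⟩
    exact ⟨k • A', hA'.smul hk, by rw [mul_smul_comm, hA, smul_mul_assoc]⟩
  refine smul c _ hc (tens_induction ⟨1, isPauli_one, by simp⟩ mul _ fun i => ?_)
  cases f i
  · exact ⟨1, isPauli_one, by simp [mat, onQubit_one]⟩
  · exact hX i
  · have : pauliY = (-Complex.I) • (pauliZ * pauliX) := by
      rw [pauliZ_mul_pauliX, smul_smul]; simp
    rw [mat, this, onQubit_smul, ← onQubit_mul]
    exact smul _ _ (neg_ne_zero.2 Complex.I_ne_zero) (mul _ _ (hZ i) (hX i))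
  · exact hZ i

/-! ### Single-qubit Clifford matrices -/

/-- Single-qubit Clifford operators. -/
def IsCliffordMat (u : Matrix (Fin 2) (Fin 2) ℂ) : Prop :=
  u ∈ unitary (Matrix (Fin 2) (Fin 2) ℂ) ∧
    ∀ a : Pauli, ∃ (b : Pauli) (c : ℂ), c ≠ 0 ∧ u * a.mat = c • (b.mat * u)

theorem isCliffordMat_one : IsCliffordMat 1 :=
  ⟨one_mem _, fun a => ⟨a, 1, one_ne_zero, by simp⟩⟩

theorem IsCliffordMat.mul {u v : Matrix (Fin 2) (Fin 2) ℂ} (hu : IsCliffordMat u)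
    (hv : IsCliffordMat v) : IsCliffordMat (u * v) := by
  refine ⟨mul_mem hu.1 hv.1, fun a => ?_⟩
  obtain ⟨b, c, hc, h⟩ := hv.2 a
  obtain ⟨b', c', hc', h'⟩ := hu.2 b
  exact ⟨b', c * c', mul_ne_zero hc hc',
    by rw [mul_assoc, h, mul_smul_comm, ← mul_assoc, h', smul_mul_assoc, smul_smul, mul_assoc]⟩

theorem tens_mul_tens_pauli {n : ℕ} {u : Fin n → Matrix (Fin 2) (Fin 2) ℂ} {f g : Fin n → Pauli}
    (h : ∀ i, ∃ c : ℂ, c ≠ 0 ∧ u i * (f i).mat = c • ((g i).mat * u i)) :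
    ∃ c : ℂ, c ≠ 0 ∧ tens u * (tens fun i => (f i).mat) =
      c • ((tens fun i => (g i).mat) * tens u) := by
  choose c hc h using h
  refine ⟨∏ i, c i, Finset.prod_ne_zero_iff.2 fun i _ => hc i, ?_⟩
  rw [tens_mul, tens_mul, ← tens_smul]
  congr 1
  exact funext h

theorem tens_mem_unitary {n : ℕ} {u : Fin n → Matrix (Fin 2) (Fin 2) ℂ}
    (hu : ∀ i, u i ∈ unitary (Matrix (Fin 2) (Fin 2) ℂ)) : tens u ∈ unitary (Op n) := by
  refine Matrix.mem_unitaryGroup_iff'.2 ?_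
  rw [star_tens, tens_mul, ← tens_one]
  congr 1
  exact funext fun i => Unitary.star_mul_self_of_mem (hu i)

theorem isClifford_tens {n : ℕ} {u : Fin n → Matrix (Fin 2) (Fin 2) ℂ}
    (hu : ∀ i, IsCliffordMat (u i)) : IsClifford (tens u) := by
  refine ⟨tens_mem_unitary fun i => (hu i).1, ?_⟩
  rintro M ⟨f, k, hk, rfl⟩
  choose g hg using fun i => (hu i).2 (f i)
  obtain ⟨c, hc, h⟩ := tens_mul_tens_pauli hg
  exact ⟨(k * c) • tens fun i => (g i).mat, (isPauli_tens g).smul (mul_ne_zero hk hc),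
    by rw [mul_smul_comm, h, smul_smul, smul_mul_assoc]⟩

theorem isClifford_onQubit {n : ℕ} (i : Fin n) {u : Matrix (Fin 2) (Fin 2) ℂ}
    (hu : IsCliffordMat u) : IsClifford (onQubit i u) := by
  rw [onQubit_eq_tens]
  refine isClifford_tens fun j => ?_
  by_cases hj : j = i
  · subst hj; simpa using hu
  · simpa [hj] using isCliffordMat_one

theorem Pauli.mat_mem_unitary (a : Pauli) : a.mat ∈ unitary (Matrix (Fin 2) (Fin 2) ℂ) :=
  Matrix.mem_unitaryGroup_iff'.2 (by
    rw [star_mat, mat_mul_self])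

theorem Pauli.isCliffordMat_mat (a : Pauli) : IsCliffordMat a.mat := by
  refine ⟨mat_mem_unitary a, fun b => ?_⟩
  rcases mat_mul_comm_or a b with h | h
  · exact ⟨b, 1, one_ne_zero, by rw [h, one_smul]⟩
  · exact ⟨b, -1, by norm_num, by rw [h, neg_one_smul]⟩

/-- The single-qubit Clifford operator exchanging two anticommuting Pauli matrices. -/
noncomputable def pauliSwap (a b : Pauli) : Matrix (Fin 2) (Fin 2) ℂ :=
  ((Real.sqrt 2 : ℝ) : ℂ)⁻¹ • (a.mat + b.mat)

/-- Since Pauli matrices are involutions, both sides are the same multiple of `1 + b a`. -/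
theorem pauliSwap_mul (a b : Pauli) : pauliSwap a b * a.mat = b.mat * pauliSwap a b := by
  simp [pauliSwap, mul_add, add_mul, mat_mul_self, add_comm]

theorem pauliSwap_comm (a b : Pauli) : pauliSwap a b = pauliSwap b a := by
  simp [pauliSwap, add_comm]

theorem isCliffordMat_pauliSwap {a b : Pauli} (ha : a ≠ I) (hb : b ≠ I) (hab : a ≠ b) :
    IsCliffordMat (pauliSwap a b) := by
  refine ⟨Matrix.mem_unitaryGroup_iff'.2 ?_, fun c => ?_⟩
  · have h2 : ((Real.sqrt 2 : ℝ) : ℂ)⁻¹ * ((Real.sqrt 2 : ℝ) : ℂ)⁻¹ = 1 / 2 := by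
      rw [← mul_inv, ← Complex.ofReal_mul, Real.mul_self_sqrt (by norm_num)]; norm_num
    have h3 : star (pauliSwap a b) = pauliSwap a b := by
      simp [pauliSwap, star_smul, star_add, star_mat]
    rw [h3, pauliSwap, smul_mul_smul_comm, h2, mul_add, add_mul, add_mul, mat_mul_self,
      mat_mul_self, mat_mul_comm_neg ha hb hab]
    rw [show (1 : Matrix (Fin 2) (Fin 2) ℂ) + b.mat * a.mat + (-(b.mat * a.mat) + 1)
      = (2 : ℂ) • 1 by rw [two_smul]; abel, smul_smul]
    norm_num
  · by_cases hca : c = a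
    · subst hca
      exact ⟨b, 1, one_ne_zero, by rw [one_smul, pauliSwap_mul]⟩
    by_cases hcb : c = b
    · subst hcb
      exact ⟨a, 1, one_ne_zero, by rw [one_smul, pauliSwap_comm, pauliSwap_mul]⟩
    by_cases hc : c = I
    · subst hc
      exact ⟨I, 1, one_ne_zero, by simp [mat]⟩
    -- The third Pauli matrix anticommutes with both summands, hence is negated.
    refine ⟨c, -1, by norm_num, ?_⟩
    rw [pauliSwap, smul_mul_assoc, mul_smul_comm, add_mul, mul_add,
      mat_mul_comm_neg ha hc (Ne.symm hca), mat_mul_comm_neg hb hc (Ne.symm hcb)]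
    simp only [neg_one_smul, ← smul_neg]
    congr 1
    abel

theorem hadamard_eq_pauliSwap : hadamard = pauliSwap X Z := by
  unfold hadamard pauliSwap
  congr 1
  ext i j; fin_cases i <;> fin_cases j <;> simp [mat, pauliX, pauliZ]

theorem isCliffordMat_hadamard : IsCliffordMat hadamard :=
  hadamard_eq_pauliSwap ▸ isCliffordMat_pauliSwap (by simp) (by simp) (by simp)

theorem sMatrix_mul_pauliX : sMatrix * pauliX = pauliY * sMatrix := by
  ext i j; fin_cases i <;> fin_cases j <;> simp [sMatrix, pauliX, pauliY, Matrix.mul_apply]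

theorem sMatrix_mul_pauliY : sMatrix * pauliY = -(pauliX * sMatrix) := by
  ext i j; fin_cases i <;> fin_cases j <;> simp [sMatrix, pauliX, pauliY, Matrix.mul_apply]

theorem sMatrix_mul_pauliZ : sMatrix * pauliZ = pauliZ * sMatrix := by
  ext i j; fin_cases i <;> fin_cases j <;> simp [sMatrix, pauliZ, Matrix.mul_apply]

theorem isCliffordMat_sMatrix : IsCliffordMat sMatrix := by
  refine ⟨Matrix.mem_unitaryGroup_iff'.2 ?_, fun a => ?_⟩
  · ext i j; fin_cases i <;> fin_cases j <;> simp [sMatrix, Matrix.mul_apply, Matrix.star_apply]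
  · cases a
    · exact ⟨I, 1, one_ne_zero, by simp [mat]⟩
    · exact ⟨Y, 1, one_ne_zero, by simpa [mat] using sMatrix_mul_pauliX⟩
    · exact ⟨X, -1, by norm_num, by simpa [mat] using sMatrix_mul_pauliY⟩
    · exact ⟨Z, 1, one_ne_zero, by simpa [mat] using sMatrix_mul_pauliZ⟩

/-- Every non-identity Pauli matrix is mapped by a single-qubit Clifford operator to any other,
and `X` and `Y` are exchanged by one that commutes with `Z`. -/
theorem exists_isCliffordMat {a b : Pauli} (hab : a = I ↔ b = I) :
    ∃ u, IsCliffordMat u ∧ (∃ c : ℂ, c ≠ 0 ∧ u * a.mat = c • (b.mat * u)) ∧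
      (a = I → u = 1) ∧
      ((a = X ∨ a = Y) → (b = X ∨ b = Y) → Commute u pauliZ) := by
  by_cases h : a = b
  · subst h
    exact ⟨1, isCliffordMat_one, ⟨1, one_ne_zero, by simp⟩, fun _ => rfl,
      fun _ _ => Commute.one_left _⟩
  have ha : a ≠ I := fun ha => h (by rw [ha, hab.1 ha])
  have hb : b ≠ I := fun hb => ha (hab.2 hb)
  -- Between `X` and `Y` the swap `(X + Y)/√2` would not commute with `Z`; the `S` gate does.
  by_cases h2 : (a = X ∨ a = Y) ∧ (b = X ∨ b = Y)
  · refine ⟨sMatrix, isCliffordMat_sMatrix, ?_, fun h => absurd h ha,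
      fun _ _ => sMatrix_mul_pauliZ⟩
    rcases h2 with ⟨rfl | rfl, rfl | rfl⟩
    · exact absurd rfl h
    · exact ⟨1, one_ne_zero, by simpa [mat] using sMatrix_mul_pauliX⟩
    · exact ⟨-1, by norm_num, by simpa [mat] using sMatrix_mul_pauliY⟩
    · exact absurd rfl h
  · exact ⟨pauliSwap a b, isCliffordMat_pauliSwap ha hb h,
      ⟨1, one_ne_zero, by rw [one_smul, pauliSwap_mul]⟩, fun h => absurd h ha,
      fun h h' => absurd ⟨h, h'⟩ h2⟩

/-! ### Operators implementable with a given number of GMS gates -/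

theorem evalCircuit_append {n : ℕ} {G : Type} (toOp : G → Op n) (c d : List G) :
    evalCircuit toOp (c ++ d) = evalCircuit toOp d * evalCircuit toOp c := by
  induction c with
  | nil => simp [evalCircuit]
  | cons g c ih => simp [evalCircuit, ih, mul_assoc]

/-- The operator is implemented by single-qubit unitaries and at most `k` GMS gates. -/
def IsImpl {n : ℕ} (k : ℕ) (U : Op n) : Prop :=
  ∃ d : List (GMSGate n), evalCircuit GMSGate.toOp d = U ∧ gmsCount d ≤ k

theorem isImpl_one {n : ℕ} : IsImpl 0 (1 : Op n) := ⟨[], rfl, le_rfl⟩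

theorem IsImpl.mono {n : ℕ} {k l : ℕ} {U : Op n} (h : IsImpl k U) (hkl : k ≤ l) : IsImpl l U :=
  let ⟨d, hd, hk⟩ := h
  ⟨d, hd, hk.trans hkl⟩

theorem IsImpl.mul {n : ℕ} {k l : ℕ} {U V : Op n} (hU : IsImpl k U) (hV : IsImpl l V) :
    IsImpl (k + l) (U * V) := by
  obtain ⟨d, rfl, hk⟩ := hU
  obtain ⟨e, rfl, hl⟩ := hV
  refine ⟨e ++ d, evalCircuit_append _ _ _, ?_⟩
  simp only [gmsCount, List.countP_append] at *
  omega

theorem isImpl_onQubit {n : ℕ} (i : Fin n) {u : Matrix (Fin 2) (Fin 2) ℂ}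
    (hu : u ∈ unitary (Matrix (Fin 2) (Fin 2) ℂ)) : IsImpl 0 (onQubit i u) :=
  ⟨[.single i ⟨u, hu⟩], by simp [evalCircuit, GMSGate.toOp], by simp [gmsCount, GMSGate.isGMS]⟩

theorem isImpl_tens {n : ℕ} {u : Fin n → Matrix (Fin 2) (Fin 2) ℂ}
    (hu : ∀ i, u i ∈ unitary (Matrix (Fin 2) (Fin 2) ℂ)) : IsImpl 0 (tens u) :=
  tens_induction isImpl_one (fun _ _ hA hB => hA.mul hB) u fun i => isImpl_onQubit i (hu i)

theorem isImpl_gmsOp {n : ℕ} (S : Finset (Fin n)) (α : ℝ) : IsImpl 1 (gmsOp S α) :=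
  ⟨[.gms S α], by simp [evalCircuit, GMSGate.toOp], by simp [gmsCount, GMSGate.isGMS]⟩

/-! ### The diagonal form of the GMS gate -/

/-- The conjugate `exp(-i (α/4) ∑_{i ≠ j ∈ S} Z_i Z_j)` of a GMS gate by Hadamard gates. -/
noncomputable def isingOp {n : ℕ} (S : Finset (Fin n)) (α : ℝ) : Op n :=
  mono (fun y => y) fun y =>
    Complex.exp ((-Complex.I * (α / 4)) * ((∑ i ∈ S, zSign i y) ^ 2 - S.card))

theorem diagonal_eq_mono {n : ℕ} (φ : (Fin n → Fin 2) → ℂ) :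
    Matrix.diagonal φ = mono (fun y => y) φ := by
  ext x y
  by_cases h : x = y
  · subst h; simp [mono]
  · simp [mono, h]

/-- The square is the sum over all ordered pairs, and each diagonal pair contributes `1`. -/
theorem sum_offDiag_zSign {n : ℕ} (S : Finset (Fin n)) (y : Fin n → Fin 2) :
    ∑ p ∈ S.offDiag, zSign p.1 y * zSign p.2 y = (∑ i ∈ S, zSign i y) ^ 2 - S.card := by
  rw [sq, Finset.sum_mul_sum, ← Finset.sum_product', ← Finset.diag_union_offDiag,
    Finset.sum_union (Finset.disjoint_diag_offDiag S), Finset.sum_diag]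
  simp [zSign_mul_self]

theorem hadamard_mul_self : hadamard * hadamard = 1 := by
  have h := Unitary.star_mul_self_of_mem isCliffordMat_hadamard.1
  rwa [hadamard_eq_pauliSwap, show star (pauliSwap X Z) = pauliSwap X Z by
    simp [pauliSwap, star_smul, star_add, star_mat], ← hadamard_eq_pauliSwap] at h

theorem tens_hadamard_mul_self {n : ℕ} :
    (tens fun _ : Fin n => hadamard) * (tens fun _ : Fin n => hadamard) = 1 := by
  rw [tens_mul, ← tens_one]
  congr 1
  exact funext fun _ => hadamard_mul_self

theorem tens_hadamard_mul_onQubit {n : ℕ} (i : Fin n) :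
    (tens fun _ : Fin n => hadamard) * onQubit i pauliX =
      onQubit i pauliZ * tens fun _ : Fin n => hadamard := by
  rw [onQubit_eq_tens, onQubit_eq_tens, tens_mul, tens_mul]
  congr 1
  funext j
  by_cases hj : j = i
  · subst hj
    simpa [hadamard_eq_pauliSwap, mat] using pauliSwap_mul X Z
  · simp [hj]

/-- The Hadamard layer is its own inverse, so conjugation by it passes inside the exponential and
turns each `X_i X_j` into the diagonal `Z_i Z_j`. -/
theorem isingOp_eq {n : ℕ} (S : Finset (Fin n)) (α : ℝ) :
    isingOp S α = (tens fun _ : Fin n => hadamard) * gmsOp S α * tens fun _ => hadamard := by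
  set T : Op n := tens fun _ => hadamard with hT
  have hTT : T * T = 1 := tens_hadamard_mul_self
  have hinv : T⁻¹ = T := Matrix.inv_eq_left_inv hTT
  have hunit : IsUnit T := ⟨⟨T, T, hTT, hTT⟩, rfl⟩
  have h := Matrix.exp_conj T
    ((-Complex.I * (α / 4)) • ∑ p ∈ S.offDiag, onQubit p.1 pauliX * onQubit p.2 pauliX) hunit
  rw [hinv] at h
  rw [gmsOp, ← h, mul_smul_comm, smul_mul_assoc, Finset.mul_sum, Finset.sum_mul]
  have h1 : ∀ p : Fin n × Fin n, T * (onQubit p.1 pauliX * onQubit p.2 pauliX) * T =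
      Matrix.diagonal fun y => zSign p.1 y * zSign p.2 y := by
    intro p
    rw [← mul_assoc, tens_hadamard_mul_onQubit, mul_assoc _ T, tens_hadamard_mul_onQubit,
      ← mul_assoc, mul_assoc _ T, hTT, mul_one, onQubit_pauliZ, onQubit_pauliZ, mono_mul,
      diagonal_eq_mono]
  have h2 : (-Complex.I * (α / 4)) • ∑ p ∈ S.offDiag,
      (Matrix.diagonal fun y : Fin n → Fin 2 => zSign p.1 y * zSign p.2 y) =
      Matrix.diagonal fun y =>
        (-Complex.I * (α / 4)) * ((∑ i ∈ S, zSign i y) ^ 2 - S.card) := by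
    ext x y
    by_cases hxy : x = y
    · subst hxy
      simp [Matrix.sum_apply, ← sum_offDiag_zSign]
    · simp [Matrix.sum_apply, hxy]
  rw [Finset.sum_congr rfl fun p _ => h1 p, h2, Matrix.exp_diagonal, diagonal_eq_mono, isingOp]
  congr 1
  funext y
  rw [Pi.coe_exp, Complex.exp_eq_exp_ℂ]

theorem isImpl_isingOp {n : ℕ} (S : Finset (Fin n)) (α : ℝ) : IsImpl 1 (isingOp S α) := by
  have h : IsImpl 0 (tens fun _ : Fin n => hadamard) :=
    isImpl_tens fun _ => isCliffordMat_hadamard.1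
  rw [isingOp_eq]
  exact (h.mul (isImpl_gmsOp S α)).mul h

/-- The Ising energy is real, so conjugation only reverses the angle. Hence the inverse of an Ising
gate also costs one GMS gate. -/
theorem star_isingOp {n : ℕ} (S : Finset (Fin n)) (α : ℝ) :
    star (isingOp S α) = isingOp S (-α) := by
  ext x y
  simp only [isingOp, mono, Matrix.star_apply]
  by_cases h : x = y
  · subst h
    have hz : (starRingEnd ℂ) (∑ i ∈ S, zSign i x) = ∑ i ∈ S, zSign i x := by
      rw [map_sum]
      refine Finset.sum_congr rfl fun i _ => ?_
      unfold zSign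
      split_ifs <;> simp
    have h4 : (starRingEnd ℂ) 4 = 4 := Complex.conj_ofNat 4
    simp [← Complex.exp_conj, hz, h4, Complex.conj_ofReal, neg_div]
  · simp [h, Ne.symm h]

theorem isingOp_mem_unitary {n : ℕ} (S : Finset (Fin n)) (α : ℝ) :
    isingOp S α ∈ unitary (Op n) := by
  refine Matrix.mem_unitaryGroup_iff'.2 ?_
  rw [star_isingOp, isingOp, isingOp, mono_mul, ← mono_id_one]
  congr 1
  funext y
  rw [← Complex.exp_add, ← Complex.exp_zero]
  congr 1
  push_cast
  ring

theorem isingOp_commute_pauliZ {n : ℕ} (S : Finset (Fin n)) (α : ℝ) (i : Fin n) :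
    Commute (isingOp S α) (onQubit i pauliZ) := by
  rw [Commute, SemiconjBy, onQubit_pauliZ, isingOp, mono_mul, mono_mul]
  simp only [mul_comm]

theorem isingOp_commute_pauliX {n : ℕ} {S : Finset (Fin n)} (α : ℝ) {i : Fin n} (hi : i ∉ S) :
    Commute (isingOp S α) (onQubit i pauliX) := by
  rw [Commute, SemiconjBy, onQubit_pauliX, isingOp, mono_mul, mono_mul]
  congr 1
  funext y
  rw [one_mul, mul_one]
  congr 4
  exact Finset.sum_congr rfl fun j hj => zSign_flipBit_of_ne (ne_of_mem_of_not_mem hj hi) y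

theorem fixesQubit_isingOp {n : ℕ} {S : Finset (Fin n)} (α : ℝ) {i : Fin n} (hi : i ∉ S) :
    FixesQubit (isingOp S α) i :=
  ⟨isingOp_commute_pauliX α hi, isingOp_commute_pauliZ S α i⟩

/-! ### The action of the Ising gate at angle `-π/2` on Pauli operators -/

/-- Powers of `Z` on each qubit, as a diagonal operator. -/
theorem tens_pauliZ_pow {n : ℕ} (e : Fin n → ℕ) :
    (tens fun i => pauliZ ^ e i) = mono (fun y => y) fun y => ∏ i, zSign i y ^ e i := by
  have hd : pauliZ = Matrix.diagonal fun a : Fin 2 => if a = 0 then (1 : ℂ) else -1 := by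
    ext i j; fin_cases i <;> fin_cases j <;> simp [pauliZ]
  ext x y
  simp only [tens, mono, hd, Matrix.diagonal_pow]
  by_cases h : x = y
  · subst h
    simp [zSign]
  · obtain ⟨j, hj⟩ := Function.ne_iff.1 h
    rw [if_neg h, Finset.prod_eq_zero (Finset.mem_univ j)]
    simp [hj]

/-- Exponents of the string of `Z` operators produced by an Ising interaction. -/
def isingExponent {n : ℕ} (S : Finset (Fin n)) (k i : Fin n) : ℕ :=
  if i = k then (S.erase k).card else if i ∈ S then 1 else 0

/-- Flipping bit `k` changes the squared sum of signs by `4 w_k r`, where `w` is the flipped state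
and `r` the sum of the signs on `S \ {k}`. The phase ratio is therefore `∏ exp(i (π/2) w_k w_i)`,
and each factor equals `i w_k w_i` because `w_k w_i = ±1`. Every partner of `k` contributes one `Z`
on itself and one on `k`. -/
theorem isingOp_mul_pauliX {n : ℕ} {S : Finset (Fin n)} {k : Fin n} (hk : k ∈ S) :
    ∃ c : ℂ, c ≠ 0 ∧ isingOp S (-(Real.pi / 2)) * onQubit k pauliX =
      c • ((tens fun i => pauliZ ^ isingExponent S k i) * onQubit k pauliX *
        isingOp S (-(Real.pi / 2))) := by
  refine ⟨Complex.I ^ (S.erase k).card, pow_ne_zero _ Complex.I_ne_zero, ?_⟩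
  rw [tens_pauliZ_pow, onQubit_pauliX, isingOp, mono_mul, mono_mul, mono_mul, smul_mono]
  congr 1
  funext y
  set w := flipBit k y with hw
  have hprod : ∏ i, zSign i w ^ isingExponent S k i =
      ∏ i ∈ S.erase k, zSign k w * zSign i w := by
    rw [Finset.prod_mul_distrib, Finset.prod_const,
      ← Finset.mul_prod_erase _ _ (Finset.mem_univ k)]
    congr 1
    · simp [isingExponent]
    · rw [← Finset.prod_subset (Finset.erase_subset_erase k (Finset.subset_univ S))]
      · refine Finset.prod_congr rfl fun i hi => ?_
        rw [Finset.mem_erase] at hi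
        simp [isingExponent, hi.1, hi.2]
      · intro i hi hi'
        simp only [Finset.mem_erase, Finset.mem_univ, and_true, not_and] at hi hi'
        simp [isingExponent, hi, hi' hi]
  have hexp : ∀ i, Complex.exp (Complex.I * (Real.pi / 2) * (zSign k w * zSign i w)) =
      Complex.I * (zSign k w * zSign i w) := by
    intro i
    have : zSign k w * zSign i w = 1 ∨ zSign k w * zSign i w = -1 := by
      unfold zSign; split_ifs <;> simp
    rcases this with h | h <;> rw [h]
    · rw [mul_one, mul_comm, Complex.exp_pi_div_two_mul_I, mul_one]
    · rw [mul_neg_one, mul_neg_one, mul_comm, ← neg_mul, ← neg_div, Complex.exp_neg_pi_div_two_mul_I]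
  rw [hprod, mul_one, mul_one, ← mul_assoc, ← Finset.prod_const, ← Finset.prod_mul_distrib,
    ← Finset.prod_congr rfl fun i _ => hexp i, ← Complex.exp_sum, ← Complex.exp_add]
  congr 1
  have h1 : ∀ z : Fin n → Fin 2, ∑ i ∈ S, zSign i z = zSign k z + ∑ i ∈ S.erase k, zSign i z :=
    fun z => (Finset.add_sum_erase _ _ hk).symm
  have h2 : ∑ i ∈ S.erase k, zSign i w = ∑ i ∈ S.erase k, zSign i y :=
    Finset.sum_congr rfl fun i hi => zSign_flipBit_of_ne (Finset.ne_of_mem_erase hi) y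
  have h3 : zSign k w = -zSign k y := zSign_flipBit_self k y
  rw [h1 w, h1 y, ← Finset.mul_sum, ← Finset.mul_sum, h2, h3]
  push_cast
  ring

theorem pauliZ_pow_eq_mat (e : ℕ) : pauliZ ^ e = Pauli.mat (if Even e then I else Z) := by
  have h2 : pauliZ ^ 2 = 1 := by rw [sq]; exact mat_mul_self Z
  split_ifs with h
  · obtain ⟨m, rfl⟩ := h
    rw [← two_mul, pow_mul, h2, one_pow]; rfl
  · obtain ⟨m, rfl⟩ := Nat.not_even_iff_odd.1 h
    rw [pow_succ, pow_mul, h2, one_pow, one_mul]; rfl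

/-- The label of `X` times the string of `Z` operators produced by an Ising interaction. -/
noncomputable def isingPauli {n : ℕ} (S : Finset (Fin n)) (k i : Fin n) : Pauli :=
  if i = k then (if Even (S.erase k).card then X else Y) else if i ∈ S then Z else I

theorem isingPauli_self {n : ℕ} (S : Finset (Fin n)) (k : Fin n) :
    isingPauli S k k = X ∨ isingPauli S k k = Y := by
  by_cases h : Even (S.erase k).card <;> simp [isingPauli, h]

theorem isingPauli_eq_I_iff {n : ℕ} {S : Finset (Fin n)} {k : Fin n} (hk : k ∈ S) (i : Fin n) :
    isingPauli S k i = I ↔ i ∉ S := by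
  by_cases hi : i = k
  · subst hi
    rcases isingPauli_self S i with h | h <;> simp [h, hk]
  · by_cases hS : i ∈ S <;> simp [isingPauli, hi, hS]

/-- On qubit `k` an even power of `Z` vanishes, while an odd one turns `X` into `i Y`. -/
theorem tens_isingPauli {n : ℕ} {S : Finset (Fin n)} {k : Fin n} :
    ∃ c : ℂ, c ≠ 0 ∧ (tens fun i => pauliZ ^ isingExponent S k i) * onQubit k pauliX =
      c • tens fun i => (isingPauli S k i).mat := by
  have key : ∀ i, ∃ c : ℂ, c ≠ 0 ∧
      pauliZ ^ isingExponent S k i *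
        (Function.update 1 k pauliX : Fin n → Matrix (Fin 2) (Fin 2) ℂ) i =
        c • (isingPauli S k i).mat := by
    intro i
    rw [pauliZ_pow_eq_mat]
    by_cases hi : i = k
    · subst hi
      by_cases h : Even (S.erase i).card
      · exact ⟨1, one_ne_zero, by simp [isingExponent, isingPauli, h, mat]⟩
      · refine ⟨Complex.I, Complex.I_ne_zero, ?_⟩
        simpa [isingExponent, isingPauli, h, mat] using pauliZ_mul_pauliX
    · refine ⟨1, one_ne_zero, ?_⟩
      by_cases hS : i ∈ S <;> simp [isingExponent, isingPauli, hi, hS, mat]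
  choose c hc h using key
  refine ⟨∏ i, c i, Finset.prod_ne_zero_iff.2 fun i _ => hc i, ?_⟩
  rw [onQubit_eq_tens, tens_mul, ← tens_smul]
  congr 1
  exact funext h

theorem isClifford_isingOp {n : ℕ} (S : Finset (Fin n)) :
    IsClifford (isingOp S (-(Real.pi / 2))) := by
  refine isClifford_of_generators (isingOp_mem_unitary _ _) (fun i => ?_)
    fun i => ⟨_, isPauli_onQubit i Z, isingOp_commute_pauliZ _ _ _⟩
  by_cases hi : i ∈ S
  · obtain ⟨c, hc, h⟩ := isingOp_mul_pauliX hi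
    obtain ⟨d, hd, h'⟩ := tens_isingPauli (S := S) (k := i)
    exact ⟨(c * d) • _, (isPauli_tens _).smul (mul_ne_zero hc hd),
      by rw [h, h', smul_mul_assoc, smul_smul, smul_mul_assoc]⟩
  · exact ⟨_, isPauli_onQubit i X, isingOp_commute_pauliX _ hi⟩

/-- The string of `Z` operators `T` commutes with the diagonal gate `E` and squares to `1`. So `E T
X_k = T E X_k = c T T X_k E = c X_k E`: up to scalars the gate acts as an involution on this pair.
-/
theorem isingOp_mul_isingPauli {n : ℕ} {S : Finset (Fin n)} {k : Fin n} (hk : k ∈ S) :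
    ∃ c : ℂ, c ≠ 0 ∧ isingOp S (-(Real.pi / 2)) * (tens fun i => (isingPauli S k i).mat) =
      c • (onQubit k pauliX * isingOp S (-(Real.pi / 2))) := by
  obtain ⟨c, hc, h⟩ := isingOp_mul_pauliX hk
  obtain ⟨d, hd, h'⟩ := tens_isingPauli (S := S) (k := k)
  set T := tens fun i => pauliZ ^ isingExponent S k i with hT
  have hTT : T * T = 1 := by
    simp only [hT, pauliZ_pow_eq_mat]
    exact tens_pauli_mul_self _
  have hTE : isingOp S (-(Real.pi / 2)) * T = T * isingOp S (-(Real.pi / 2)) := by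
    rw [hT, tens_pauliZ_pow, isingOp, mono_mul, mono_mul]
    simp only [mul_comm]
  refine ⟨d⁻¹ * c, mul_ne_zero (inv_ne_zero hd) hc, ?_⟩
  have h'' : (tens fun i => (isingPauli S k i).mat) = d⁻¹ • (T * onQubit k pauliX) := by
    rw [h', smul_smul, inv_mul_cancel₀ hd, one_smul]
  rw [h'', mul_smul_comm, ← mul_assoc, hTE, mul_assoc, h, mul_smul_comm, smul_smul,
    ← mul_assoc T, ← mul_assoc T, hTT, one_mul]

/-! ### Reducing Pauli strings with a single GMS gate -/

/-- A Pauli string containing qubit `q` is mapped to `X` on qubit `q` by an operator whose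
inverse takes one GMS gate. -/
theorem exists_reduce_tens {n : ℕ} {f : Fin n → Pauli} {q : Fin n} (hq : f q ≠ I) :
    ∃ V : Op n, IsClifford V ∧ IsImpl 1 (star V) ∧
      (∃ c : ℂ, c ≠ 0 ∧ V * (tens fun i => (f i).mat) = c • (onQubit q pauliX * V)) ∧
      (∀ i, f i = I → FixesQubit V i) ∧
      ((f q = X ∨ f q = Y) → Commute V (onQubit q pauliZ)) := by
  classical
  set S : Finset (Fin n) := Finset.univ.filter fun i => f i ≠ I with hS
  have hqS : q ∈ S := by simp [hS, hq]
  -- With `S` the support of the string, both label families are trivial on the same qubits, so they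
  -- match under local Cliffords.
  choose u hu hug hu1 huZ using fun i => exists_isCliffordMat (a := f i) (b := isingPauli S q i)
    (by rw [isingPauli_eq_I_iff hqS]; simp [hS])
  obtain ⟨c, hc, h⟩ := tens_mul_tens_pauli hug
  obtain ⟨d, hd, h'⟩ := isingOp_mul_isingPauli hqS
  refine ⟨isingOp S (-(Real.pi / 2)) * tens u, (isClifford_isingOp S).mul (isClifford_tens hu),
    ?_, ⟨c * d, mul_ne_zero hc hd, ?_⟩, fun i hi => ?_, fun hXY => ?_⟩
  · rw [star_mul, star_tens, star_isingOp]
    exact (isImpl_tens fun i => Unitary.star_mem (hu i).1).mul (isImpl_isingOp _ _)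
  · rw [mul_assoc, h, mul_smul_comm, ← mul_assoc, h', smul_mul_assoc, smul_smul, mul_assoc]
  · exact (fixesQubit_isingOp _ (by simp [hS, hi])).mul (fixesQubit_tens (hu1 i hi))
  · exact (isingOp_commute_pauliZ _ _ _).mul_left
      (commute_onQubit_tens (huZ q hXY (isingPauli_self S q)).symm).symm

theorem mul_left_cancel_of_mem_unitary {n : ℕ} {C M N : Op n} (hC : C ∈ unitary (Op n))
    (h : C * M = C * N) : M = N := by
  rw [← one_mul M, ← Unitary.star_mul_self_of_mem hC, mul_assoc, h, ← mul_assoc,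
    Unitary.star_mul_self_of_mem hC, one_mul]

theorem mul_right_cancel_of_mem_unitary {n : ℕ} {C M N : Op n} (hC : C ∈ unitary (Op n))
    (h : M * C = N * C) : M = N := by
  rw [← mul_one M, ← Unitary.mul_star_self_of_mem hC, ← mul_assoc, h, mul_assoc,
    Unitary.mul_star_self_of_mem hC, mul_one]

theorem mul_self_of_conj {n : ℕ} {C M M' : Op n} (hC : C ∈ unitary (Op n))
    (h : C * M = M' * C) (hM : M * M = 1) : M' * M' = 1 := by
  refine mul_right_cancel_of_mem_unitary hC ?_
  rw [mul_assoc, ← h, ← mul_assoc, ← h, mul_assoc, hM, mul_one, one_mul]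

theorem commute_of_conj {n : ℕ} {C M M' B : Op n} (hC : C ∈ unitary (Op n))
    (h : C * M = M' * C) (hM : Commute M B) (hCB : Commute C B) : Commute M' B := by
  refine mul_right_cancel_of_mem_unitary hC ?_
  rw [mul_assoc, ← hCB.eq, ← mul_assoc, ← h, mul_assoc, hM.eq, ← mul_assoc, hCB.eq, mul_assoc,
    h, mul_assoc]

theorem fixesQubit_of_conj {n : ℕ} {C M M' : Op n} {i : Fin n} (hC : C ∈ unitary (Op n))
    (h : C * M = M' * C) (hM : FixesQubit M i) (hCi : FixesQubit C i) : FixesQubit M' i :=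
  ⟨commute_of_conj hC h hM.1 hCi.1, commute_of_conj hC h hM.2 hCi.2⟩

/-- Squaring the conjugated string forces `c² = 1`, so only a sign remains to be corrected. -/
theorem eq_one_or_neg_one_of_conj {n : ℕ} {C M N : Op n} {c : ℂ} (hC : C ∈ unitary (Op n))
    (h : C * M = c • (N * C)) (hM : M * M = 1) (hN : N * N = 1) : c = 1 ∨ c = -1 := by
  rw [← smul_mul_assoc] at h
  have h1 := mul_self_of_conj hC h hM
  rw [smul_mul_smul_comm, hN] at h1
  have h2 := congrFun (congrFun h1 (fun _ => 0)) (fun _ => 0)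
  simp only [Matrix.smul_apply, Matrix.one_apply_eq, smul_eq_mul, mul_one] at h2
  exact mul_self_eq_one_iff.1 h2

/-- Composing with a single-qubit Clifford operator costs no GMS gates. -/
theorem isImpl_star_onQubit_mul {n k : ℕ} {V : Op n} {u : Matrix (Fin 2) (Fin 2) ℂ} (q : Fin n)
    (hu : IsCliffordMat u) (h : IsImpl k (star V)) : IsImpl k (star (onQubit q u * V)) := by
  rw [star_mul, star_onQubit]
  exact h.mul (isImpl_onQubit q (Unitary.star_mem hu.1))

/-- A Pauli string of order two containing qubit `q` is mapped to `Z` on qubit `q`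
with one GMS gate. -/
theorem exists_reduce_to_pauliZ {n : ℕ} {M : Op n} {q : Fin n} (hM : IsPauli M)
    (hMM : M * M = 1) (hq : ¬ FixesQubit M q) :
    ∃ V : Op n, IsClifford V ∧ IsImpl 1 (star V) ∧ V * M = onQubit q pauliZ * V ∧
      ∀ i, FixesQubit M i → FixesQubit V i := by
  obtain ⟨f, k, hk, rfl⟩ := hM
  rw [fixesQubit_pauli_iff hk] at hq
  obtain ⟨V, hV, hVi, ⟨c, hc, h⟩, hVf, -⟩ := exists_reduce_tens hq
  have h' : V * (k • tens fun i => (f i).mat) = (k * c) • (onQubit q pauliX * V) := by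
    rw [mul_smul_comm, h, smul_smul]
  have hf : ∀ u : Matrix (Fin 2) (Fin 2) ℂ, ∀ i, FixesQubit (k • tens fun i => (f i).mat) i →
      FixesQubit (onQubit q u * V) i := by
    intro u i hi
    rw [fixesQubit_pauli_iff hk] at hi
    exact (fixesQubit_onQubit (by rintro rfl; exact hq hi) u).mul (hVf i hi)
  have hHX : hadamard * pauliX = pauliZ * hadamard := by
    rw [hadamard_eq_pauliSwap]
    exact pauliSwap_mul X Z
  rcases eq_one_or_neg_one_of_conj hV.1 h' hMM (onQubit_mat_mul_self q X) with h1 | h1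
  · refine ⟨onQubit q hadamard * V, (isClifford_onQubit q isCliffordMat_hadamard).mul hV,
      isImpl_star_onQubit_mul q isCliffordMat_hadamard hVi, ?_, hf _⟩
    rw [mul_assoc, h', h1, one_smul, ← mul_assoc, onQubit_mul, hHX, ← onQubit_mul, mul_assoc]
  -- The wrong sign is repaired by an extra `X`, which anticommutes with `Z`.
  · have hu : IsCliffordMat (pauliX * hadamard) := (isCliffordMat_mat X).mul isCliffordMat_hadamard
    refine ⟨onQubit q (pauliX * hadamard) * V, (isClifford_onQubit q hu).mul hV,
      isImpl_star_onQubit_mul q hu hVi, ?_, hf _⟩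
    have hXHX : pauliX * hadamard * ((-1 : ℂ) • pauliX) = pauliZ * (pauliX * hadamard) := by
      rw [mul_assoc, mul_smul_comm, hHX, mul_smul_comm, ← mul_assoc, pauliX_mul_pauliZ,
        neg_mul, neg_one_smul, neg_neg, mul_assoc]
    rw [mul_assoc, h', h1, ← smul_mul_assoc, ← onQubit_smul, ← mul_assoc, onQubit_mul, hXHX,
      ← onQubit_mul, mul_assoc]

/-- A Pauli string of order two anticommuting with `Z` on qubit `q` is mapped to `X` on
qubit `q` with one GMS gate, by an operator commuting with `Z` on qubit `q`. -/
theorem exists_reduce_to_pauliX {n : ℕ} {M : Op n} {q : Fin n} (hM : IsPauli M)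
    (hMM : M * M = 1) (hq : onQubit q pauliZ * M = -(M * onQubit q pauliZ)) :
    ∃ V : Op n, IsClifford V ∧ IsImpl 1 (star V) ∧ V * M = onQubit q pauliX * V ∧
      Commute V (onQubit q pauliZ) ∧ ∀ i, FixesQubit M i → FixesQubit V i := by
  obtain ⟨f, k, hk, rfl⟩ := hM
  have hnc : ¬ Commute pauliZ (f q).mat := by
    intro hcomm
    have h0 := eq_zero_of_commute_of_anticommute (onQubit_mat_mul_self q Z)
      ((commute_onQubit_tens (A := fun i => (f i).mat) hcomm).smul_right k) hq
    exact IsPauli.ne_zero ⟨f, k, hk, rfl⟩ h0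
  have hXY : f q = X ∨ f q = Y := by
    cases hfq : f q
    · exact absurd (by rw [hfq]; exact Commute.one_right _) hnc
    · exact Or.inl rfl
    · exact Or.inr rfl
    · exact absurd (by rw [hfq]; exact Commute.refl _) hnc
  have hq : f q ≠ I := by rcases hXY with h | h <;> simp [h]
  obtain ⟨V, hV, hVi, ⟨c, hc, h⟩, hVf, hVZ⟩ := exists_reduce_tens hq
  have hVZ := hVZ hXY
  have h' : V * (k • tens fun i => (f i).mat) = (k * c) • (onQubit q pauliX * V) := by
    rw [mul_smul_comm, h, smul_smul]
  rcases eq_one_or_neg_one_of_conj hV.1 h' hMM (onQubit_mat_mul_self q X) with h1 | h1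
  · refine ⟨V, hV, hVi, by rw [h', h1, one_smul], hVZ, fun i hi => hVf i ?_⟩
    rwa [fixesQubit_pauli_iff hk] at hi
  -- Here the sign is repaired by `Z`, which anticommutes with `X` and preserves commutation with
  -- `Z_q`.
  · refine ⟨onQubit q pauliZ * V, (isClifford_onQubit q (isCliffordMat_mat Z)).mul hV,
      isImpl_star_onQubit_mul q (isCliffordMat_mat Z) hVi, ?_,
      (Commute.refl _).mul_left hVZ, fun i hi => ?_⟩
    · have hZX : pauliZ * ((-1 : ℂ) • pauliX) = pauliX * pauliZ := by
        rw [pauliX_mul_pauliZ, mul_smul_comm, neg_one_smul]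
      rw [mul_assoc, h', h1, ← smul_mul_assoc, ← onQubit_smul, ← mul_assoc, onQubit_mul, hZX,
        ← onQubit_mul, mul_assoc]
    · rw [fixesQubit_pauli_iff hk] at hi
      exact (fixesQubit_onQubit (by rintro rfl; exact hq hi) _).mul (hVf i hi)

/-- A Pauli string that is not a scalar can be made to contain any given qubit
with one GMS gate. -/
theorem exists_extend_support {n : ℕ} {M : Op n} {q j : Fin n} (hM : IsPauli M)
    (hj : ¬ FixesQubit M j) :
    ∃ V M' : Op n, IsClifford V ∧ IsImpl 1 (star V) ∧ IsPauli M' ∧ V * M = M' * V ∧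
      ¬ FixesQubit M' q ∧ ∀ i, i ≠ q → FixesQubit M i → FixesQubit V i := by
  classical
  by_cases hq : FixesQubit M q
  swap
  · refine ⟨1, M, isClifford_one, ?_, hM, by simp, hq,
      fun i _ _ => ⟨Commute.one_left _, Commute.one_left _⟩⟩
    rw [star_one]
    exact isImpl_one.mono zero_le_one
  obtain ⟨f, k, hk, rfl⟩ := hM
  rw [fixesQubit_pauli_iff hk] at hq hj
  have hjq : j ≠ q := fun h => hj (h ▸ hq)
  obtain ⟨u, hu, ⟨c, hc, h⟩, -, -⟩ := exists_isCliffordMat (a := f j) (b := X) (by simp [hj])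
  -- Once the label at `j` is `X`, an Ising gate on `q` and `j` alone spreads it to `q`.
  set S : Finset (Fin n) := {q, j} with hS
  have hqS : q ∈ S := by simp [hS]
  set g := Function.update f j X with hg
  have hL : ∃ c : ℂ, c ≠ 0 ∧ onQubit j u * (tens fun i => (f i).mat) =
      c • ((tens fun i => (g i).mat) * onQubit j u) := by
    rw [onQubit_eq_tens]
    refine tens_mul_tens_pauli fun i => ?_
    by_cases hi : i = j
    · subst hi
      exact ⟨c, hc, by simpa [hg] using h⟩
    · exact ⟨1, one_ne_zero, by simp [hi, hg]⟩
  obtain ⟨d, hd, hL⟩ := hL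
  set E := isingOp S (-(Real.pi / 2)) with hE
  obtain ⟨M', hM', hEM⟩ := (isClifford_isingOp S).2 _ (isPauli_tens g)
  obtain ⟨e, he, hEG⟩ := isingOp_mul_isingPauli hqS
  rw [← hE] at hEM hEG
  refine ⟨E * onQubit j u, (k * d) • M', (isClifford_isingOp S).mul (isClifford_onQubit j hu),
    ?_, hM'.smul (mul_ne_zero hk hd), ?_, ?_, ?_⟩
  · rw [star_mul, star_onQubit, hE, star_isingOp]
    exact (isImpl_onQubit j (Unitary.star_mem hu.1)).mul (isImpl_isingOp _ _)
  · rw [mul_smul_comm, mul_assoc, hL, mul_smul_comm, ← mul_assoc, hEM, smul_smul,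
      smul_mul_assoc, mul_assoc]
  -- If `q` were still outside the support, the new string would commute with `X_q`. Pulled back
  -- through `E`, the string `g` would commute with the Ising string of `q`. But `g` has `I` at `q`
  -- and `X` at `j`, where the Ising string has `Z`, so the two anticommute.
  · intro hfix
    have hX : Commute M' (onQubit q pauliX) := by
      have := hfix.1.smul_left (k * d)⁻¹
      rwa [smul_smul, inv_mul_cancel₀ (mul_ne_zero hk hd), one_smul] at this
    have hcomm : Commute (tens fun i => (g i).mat) (tens fun i => (isingPauli S q i).mat) := by
      refine mul_left_cancel_of_mem_unitary (isClifford_isingOp S).1 ?_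
      rw [← hE, ← mul_assoc, hEM, mul_assoc, hEG, ← mul_assoc, hEG, mul_smul_comm,
        ← mul_assoc, hX.eq, smul_mul_assoc, mul_assoc, mul_assoc, hEM]
    have hanti : (tens fun i => (g i).mat) * (tens fun i => (isingPauli S q i).mat) =
        -((tens fun i => (isingPauli S q i).mat) * tens fun i => (g i).mat) := by
      have h1 : (tens fun i => (g i).mat) =
          onQubit j pauliX * tens fun i => (Function.update f j I i).mat := by
        rw [onQubit_eq_tens, tens_mul]
        congr 1
        funext i
        by_cases hi : i = j
        · subst hi; simp [hg, mat]
        · simp [hg, hi]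
      have h2 : Commute (tens fun i => (Function.update f j I i).mat)
          (tens fun i => (isingPauli S q i).mat) := by
        rw [Commute, SemiconjBy, tens_mul, tens_mul]
        congr 1
        funext i
        by_cases hi : i ∈ S
        · have : Function.update f j I i = I := by
            rcases Finset.mem_insert.1 hi with rfl | hi
            · simp [Ne.symm hjq, hq]
            · rw [Finset.mem_singleton.1 hi]; simp
          simp [this, mat]
        · have := (isingPauli_eq_I_iff hqS i).2 hi
          simp [this, mat]
      have h3 : isingPauli S q j = Z := by simp [isingPauli, hjq, hS]
      rw [h1, mul_assoc, h2.eq, ← mul_assoc, onQubit_mul_tens_neg, neg_mul, mul_assoc]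
      rw [h3]
      exact pauliX_mul_pauliZ
    exact (isPauli_tens _).ne_zero
      (eq_zero_of_commute_of_anticommute (tens_pauli_mul_self g) hcomm hanti)
  · intro i hiq hi
    rw [fixesQubit_pauli_iff hk] at hi
    have hij : j ≠ i := fun h => hj (h ▸ hi)
    exact (fixesQubit_isingOp _ (by simp [hS, hiq, hij.symm])).mul (fixesQubit_onQubit hij _)

/-! ### Synthesis of Clifford operators -/

theorem mul_mono_apply {n : ℕ} (C : Op n) (π : (Fin n → Fin 2) → (Fin n → Fin 2))
    (φ : (Fin n → Fin 2) → ℂ) (x y : Fin n → Fin 2) :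
    (C * mono π φ) x y = C x (π y) * φ y := by
  simp [Matrix.mul_apply, mono]

theorem mono_mul_apply {n : ℕ} (C : Op n) {π : (Fin n → Fin 2) → (Fin n → Fin 2)}
    (hπ : Function.Involutive π) (φ : (Fin n → Fin 2) → ℂ) (x y : Fin n → Fin 2) :
    (mono π φ * C) x y = φ (π x) * C (π x) y := by
  have h : ∀ z, x = π z ↔ z = π x := fun z =>
    ⟨fun h => by rw [h, hπ], fun h => by rw [h, hπ]⟩
  simp [Matrix.mul_apply, mono, h]

theorem onQubit_injective {n : ℕ} (q : Fin n) :
    Function.Injective (onQubit q : Matrix (Fin 2) (Fin 2) ℂ → Op n) := by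
  intro U V h
  ext a b
  have := congrFun (congrFun h (Function.update 0 q a)) (Function.update 0 q b)
  have h' : ∀ j, j ≠ q → (Function.update 0 q a : Fin n → Fin 2) j =
      (Function.update 0 q b : Fin n → Fin 2) j :=
    fun j hj => by simp [hj]
  simpa [onQubit, if_pos h'] using this

/-- An operator commuting with the Pauli operators of all qubits but `q` acts on `q` only. -/
theorem exists_eq_onQubit {n : ℕ} {C : Op n} {q : Fin n} (hC : ∀ i, i ≠ q → FixesQubit C i) :
    ∃ u, C = onQubit q u := by
  classical
  -- Commuting with `Z_i` makes `C` diagonal in bit `i`; commuting with `X_i` makes its entries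
  -- invariant under flipping bit `i` in both indices. Hence equal bits off `q` can be reset to `0`.
  have hZ : ∀ i, i ≠ q → ∀ x y, x i ≠ y i → C x y = 0 := by
    intro i hi x y hxy
    have h := congrFun (congrFun (hC i hi).2.eq x) y
    rw [onQubit_pauliZ, mul_mono_apply, mono_mul_apply _ (fun _ => rfl)] at h
    have hs : zSign i y = -zSign i x := by
      unfold zSign
      revert hxy
      generalize x i = a
      generalize y i = b
      fin_cases a <;> fin_cases b <;> simp
    have hx := zSign_mul_self i x
    rw [hs] at h
    linear_combination (-zSign i x / 2) * h - C x y * hx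
  have hX : ∀ i, i ≠ q → ∀ x y, C (flipBit i x) (flipBit i y) = C x y := by
    intro i hi x y
    have h := congrFun (congrFun (hC i hi).1.eq (flipBit i x)) y
    rwa [onQubit_pauliX, mul_mono_apply, mono_mul_apply _ (flipBit_involutive i),
      flipBit_involutive i, one_mul, mul_one] at h
  have key : ∀ s : Finset (Fin n), q ∉ s → ∀ x y : Fin n → Fin 2, (∀ i ∈ s, x i = y i) →
      C x y = C (fun i => if i ∈ s then 0 else x i) (fun i => if i ∈ s then 0 else y i) := by
    intro s
    induction s using Finset.induction_on with
    | empty => simp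
    | insert a s ha ih =>
      intro hq x y hxy
      rw [Finset.mem_insert, not_or] at hq
      rw [ih hq.2 x y fun i hi => hxy i (Finset.mem_insert_of_mem hi)]
      have hxa := hxy a (Finset.mem_insert_self a s)
      have hzero : ∀ z : Fin n → Fin 2, z a = 0 →
          (fun i => if i ∈ insert a s then 0 else z i) = fun i => if i ∈ s then 0 else z i := by
        intro z hz
        funext i
        by_cases hi : i = a
        · subst hi; simp [hz]
        · simp [hi]
      have hone : ∀ z : Fin n → Fin 2, z a = 1 →
          (fun i => if i ∈ insert a s then 0 else z i) =
            flipBit a fun i => if i ∈ s then 0 else z i := by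
        intro z hz
        funext i
        by_cases hi : i = a
        · subst hi; simp [flipBit, ha, hz]
        · simp [flipBit, hi]
      rcases (show x a = 0 ∨ x a = 1 by generalize x a = b; fin_cases b <;> simp) with h | h
      · rw [hzero x h, hzero y (hxa ▸ h)]
      · rw [hone x h, hone y (hxa ▸ h), hX a (Ne.symm hq.1)]
  refine ⟨fun a b => C (Function.update 0 q a) (Function.update 0 q b), ?_⟩
  ext x y
  simp only [onQubit]
  split_ifs with h
  · rw [key (Finset.univ.erase q) (by simp) x y fun i hi => h i (Finset.ne_of_mem_erase hi)]
    congr 1 <;>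
    · funext i
      by_cases hi : i = q
      · subst hi; simp
      · simp [hi]
  · push Not at h
    obtain ⟨i, hi, hxy⟩ := h
    exact hZ i hi x y hxy

theorem isImpl_zero_of_fixesQubit {n : ℕ} {C : Op n} {q : Fin n} (hC : C ∈ unitary (Op n))
    (h : ∀ i, i ≠ q → FixesQubit C i) : IsImpl 0 C := by
  obtain ⟨u, rfl⟩ := exists_eq_onQubit h
  refine isImpl_onQubit q (Matrix.mem_unitaryGroup_iff'.2 (onQubit_injective q ?_))
  rw [← onQubit_mul, ← star_onQubit, Unitary.star_mul_self_of_mem hC, onQubit_one]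

theorem onQubit_pauliX_mul_pauliZ {n : ℕ} (q : Fin n) :
    onQubit q pauliX * onQubit q pauliZ = -(onQubit q pauliZ * onQubit q pauliX) := by
  rw [onQubit_mul, onQubit_mul, pauliX_mul_pauliZ, ← neg_one_smul ℂ, onQubit_smul,
    neg_one_smul]

/-- The image of a Pauli `Z` operator under a Clifford operator is not a scalar. -/
theorem exists_not_fixesQubit {n : ℕ} {C M : Op n} {q : Fin n} (hC : C ∈ unitary (Op n))
    (hM : IsPauli M) (h : C * onQubit q pauliZ = M * C) : ∃ j, ¬ FixesQubit M j := by
  by_contra! hall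
  obtain ⟨c, rfl⟩ := hM.eq_smul_one hall
  -- A scalar image forces `Z_q` itself to be scalar, although it anticommutes with `X_q`.
  have hZ : onQubit q pauliZ = c • 1 := mul_left_cancel_of_mem_unitary hC (by
    rw [h, smul_mul_assoc, mul_smul_comm, one_mul, mul_one])
  have hanti := onQubit_pauliX_mul_pauliZ q
  refine (isPauli_onQubit q X).ne_zero (eq_zero_of_commute_of_anticommute
    (onQubit_mat_mul_self q Z) ?_ (neg_eq_iff_eq_neg.1 hanti.symm))
  rw [mat, mat, hZ]
  exact (Commute.one_left _).smul_left c

theorem anticommute_of_conj {n : ℕ} {C M M' B : Op n} (hC : C ∈ unitary (Op n))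
    (h : C * M = M' * C) (hCB : Commute C B) (hM : B * M = -(M * B)) : B * M' = -(M' * B) := by
  refine mul_right_cancel_of_mem_unitary hC ?_
  rw [mul_assoc, ← h, ← mul_assoc, ← hCB.eq, mul_assoc, hM, mul_neg, ← mul_assoc, h, neg_mul,
    mul_assoc, hCB.eq, mul_assoc]

/-- One more qubit of a Clifford operator is made trivial with three GMS gates. -/
theorem IsClifford.exists_fix_qubit {n : ℕ} {C : Op n} {q : Fin n} {A : Finset (Fin n)}
    (hC : IsClifford C) (hq : q ∉ A) (hA : ∀ i ∈ A, FixesQubit C i) :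
    ∃ V : Op n, V ∈ unitary (Op n) ∧ IsImpl 3 (star V) ∧ IsClifford (V * C) ∧
      ∀ i ∈ insert q A, FixesQubit (V * C) i := by
  have hne : ∀ i ∈ A, i ≠ q := fun i hi => ne_of_mem_of_not_mem hi hq
  obtain ⟨M, hM, hCM⟩ := hC.2 _ (isPauli_onQubit q Z)
  obtain ⟨j, hj⟩ := exists_not_fixesQubit hC.1 hM hCM
  -- The image of `Z_q` avoids the qubits already fixed, so the gates built from it leave them
  -- alone.
  have hMA : ∀ i ∈ A, FixesQubit M i := fun i hi =>
    fixesQubit_of_conj hC.1 hCM (fixesQubit_onQubit (hne i hi).symm _) (hA i hi)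
  have hMM := mul_self_of_conj hC.1 hCM (onQubit_mat_mul_self q Z)
  obtain ⟨V₀, M₀, hV₀, hV₀i, hM₀, hVM₀, hM₀q, hV₀f⟩ := exists_extend_support (q := q) hM hj
  have hV₀A : ∀ i ∈ A, FixesQubit V₀ i := fun i hi => hV₀f i (hne i hi) (hMA i hi)
  have hM₀A : ∀ i ∈ A, FixesQubit M₀ i := fun i hi =>
    fixesQubit_of_conj hV₀.1 hVM₀ (hMA i hi) (hV₀A i hi)
  obtain ⟨V₁, hV₁, hV₁i, hVM₁, hV₁f⟩ :=
    exists_reduce_to_pauliZ hM₀ (mul_self_of_conj hV₀.1 hVM₀ hMM) hM₀q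
  have hC₁ : IsClifford (V₁ * (V₀ * C)) := hV₁.mul (hV₀.mul hC)
  have hC₁A : ∀ i ∈ A, FixesQubit (V₁ * (V₀ * C)) i := fun i hi =>
    (hV₁f i (hM₀A i hi)).mul ((hV₀A i hi).mul (hA i hi))
  have hC₁Z : Commute (V₁ * (V₀ * C)) (onQubit q pauliZ) := by
    have hCM' : C * onQubit q pauliZ = M * C := hCM
    rw [Commute, SemiconjBy, mul_assoc, mul_assoc, hCM', ← mul_assoc V₀, hVM₀, mul_assoc M₀,
      ← mul_assoc, hVM₁, mul_assoc]
  obtain ⟨M₁, hM₁, hCM₁⟩ := hC₁.2 _ (isPauli_onQubit q X)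
  have hM₁A : ∀ i ∈ A, FixesQubit M₁ i := fun i hi =>
    fixesQubit_of_conj hC₁.1 hCM₁ (fixesQubit_onQubit (hne i hi).symm _) (hC₁A i hi)
  -- Now that `Z_q` is preserved, the image of `X_q` anticommutes with it. This puts `q` in the
  -- support, so no further extending gate is needed.
  have hanti : onQubit q pauliZ * M₁ = -(M₁ * onQubit q pauliZ) :=
    anticommute_of_conj hC₁.1 hCM₁ hC₁Z (neg_eq_iff_eq_neg.1 (onQubit_pauliX_mul_pauliZ q).symm)
  obtain ⟨V₂, hV₂, hV₂i, hVM₂, hV₂Z, hV₂f⟩ := exists_reduce_to_pauliX hM₁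
    (mul_self_of_conj hC₁.1 hCM₁ (onQubit_mat_mul_self q X)) hanti
  have hassoc : V₂ * V₁ * V₀ * C = V₂ * (V₁ * (V₀ * C)) := by simp only [mul_assoc]
  refine ⟨V₂ * V₁ * V₀, mul_mem (mul_mem hV₂.1 hV₁.1) hV₀.1, ?_, ?_, fun i hi => ?_⟩
  · rw [star_mul, star_mul]
    exact hV₀i.mul (hV₁i.mul hV₂i)
  · rw [hassoc]
    exact hV₂.mul hC₁
  rw [hassoc]
  rcases Finset.mem_insert.1 hi with rfl | hi
  · refine ⟨?_, hV₂Z.mul_left hC₁Z⟩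
    have hCM₁' : V₁ * (V₀ * C) * onQubit i pauliX = M₁ * (V₁ * (V₀ * C)) := hCM₁
    rw [Commute, SemiconjBy, mul_assoc, hCM₁', ← mul_assoc, hVM₂, mul_assoc]
  · exact (hV₂f i (hM₁A i hi)).mul (hC₁A i hi)

/-- Every Clifford operator on `n` qubits is implemented with `3 (n - 1)` GMS gates. -/
theorem IsClifford.isImpl {n : ℕ} (m : ℕ) {C : Op n} {A : Finset (Fin n)} (hC : IsClifford C)
    (hA : ∀ i ∈ A, FixesQubit C i) (hm : Aᶜ.card = m + 1) : IsImpl (3 * m) C := by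
  induction m generalizing C A with
  | zero =>
    -- The last unfixed qubit is free, which is why `m + 1` remaining qubits cost `3 * m`.
    obtain ⟨q, hq⟩ := Finset.card_eq_one.1 hm
    refine isImpl_zero_of_fixesQubit (q := q) hC.1 fun i hi => hA i ?_
    by_contra h
    exact hi (Finset.mem_singleton.1 (hq ▸ Finset.mem_compl.2 h))
  | succ m ih =>
    obtain ⟨q, hq⟩ := Finset.card_pos.1 (by omega : 0 < Aᶜ.card)
    obtain ⟨V, hV, hVi, hVC, hVA⟩ := hC.exists_fix_qubit (Finset.mem_compl.1 hq) hA
    have h := ih hVC hVA (by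
      rw [Finset.compl_insert, Finset.card_erase_of_mem hq, hm]; omega)
    have h' := hVi.mul h
    rw [← mul_assoc, Unitary.star_mul_self_of_mem hV, one_mul] at h'
    exact h'.mono (by omega)

/-! ### Clifford+Phases circuits -/

/-- Being affine in `Z`, a phase gate follows `Z` under conjugation: `D Z_i = Z_q D` implies `D
Z_i(α) = Z_q(α) D`. -/
theorem zPhase_eq (α : ℝ) : zPhase α =
    (Complex.cos (α / 2)) • (1 : Matrix (Fin 2) (Fin 2) ℂ) +
      (-(Complex.I * Complex.sin (α / 2))) • pauliZ := by
  have h1 : Complex.exp (-Complex.I * (α / 2)) =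
      Complex.cos (α / 2) - Complex.I * Complex.sin (α / 2) := by
    rw [show -Complex.I * ((α : ℂ) / 2) = -((α : ℂ) / 2) * Complex.I by ring,
      Complex.exp_mul_I, Complex.cos_neg, Complex.sin_neg]
    ring
  have h2 : Complex.exp (Complex.I * (α / 2)) =
      Complex.cos (α / 2) + Complex.I * Complex.sin (α / 2) := by
    rw [mul_comm, Complex.exp_mul_I]
    ring
  rw [zPhase, h1, h2]
  ext i j; fin_cases i <;> fin_cases j <;> simp [pauliZ]
  ring

theorem zPhase_add (α β : ℝ) : zPhase (α + β) = zPhase α * zPhase β := by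
  ext i j
  fin_cases i <;> fin_cases j <;>
    simp only [zPhase, Matrix.mul_apply, Fin.sum_univ_two, Fin.zero_eta, Fin.mk_one,
      Matrix.of_apply, Matrix.cons_val', Matrix.cons_val_zero, Matrix.cons_val_one,
      Matrix.cons_val_fin_one, mul_zero, zero_mul, add_zero, zero_add, ← Complex.exp_add]
  all_goals
    congr 1
    push_cast
    ring

theorem zPhase_zero : zPhase 0 = 1 := by
  ext i j; fin_cases i <;> fin_cases j <;> simp [zPhase]

theorem star_zPhase (α : ℝ) : star (zPhase α) = zPhase (-α) := by
  have h2 : (starRingEnd ℂ) 2 = 2 := Complex.conj_ofNat 2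
  ext i j; fin_cases i <;> fin_cases j <;>
    simp [zPhase, Matrix.star_apply, ← Complex.exp_conj, Complex.conj_ofReal, h2, neg_div]

theorem zPhase_mem_unitary (α : ℝ) : zPhase α ∈ unitary (Matrix (Fin 2) (Fin 2) ℂ) :=
  Matrix.mem_unitaryGroup_iff'.2 (by rw [star_zPhase, ← zPhase_add, neg_add_cancel, zPhase_zero])

/-- The matrix is `(1 - ε i Z)/√2`, which conjugates `X` to `ε Y` and `Y` to `-ε X`. All multiples
of `π/2` follow by additivity of the angle. -/
theorem isCliffordMat_zPhase_of_sign {ε : ℝ} (hε : ε = 1 ∨ ε = -1) :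
    IsCliffordMat (zPhase (ε * (Real.pi / 2))) := by
  set r : ℂ := ((Real.sqrt 2 / 2 : ℝ) : ℂ) with hr
  have h : zPhase (ε * (Real.pi / 2)) = r • (1 + (-(ε * Complex.I) : ℂ) • pauliZ) := by
    have hc : Complex.cos ((Real.pi : ℂ) / 4) = r := by
      rw [hr, ← Real.cos_pi_div_four]; push_cast; rfl
    have hs : Complex.sin ((Real.pi : ℂ) / 4) = r := by
      rw [hr, ← Real.sin_pi_div_four]; push_cast; rfl
    rw [zPhase_eq, smul_add, smul_smul]
    have h4 : ((ε * (Real.pi / 2) : ℝ) : ℂ) / 2 = ε * (Real.pi / 4) := by push_cast; ring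
    rw [h4]
    rcases hε with rfl | rfl
    · simp only [Complex.ofReal_one, one_mul, hc, hs]
      rw [mul_neg, mul_comm]
    · simp only [Complex.ofReal_neg, Complex.ofReal_one, neg_mul, one_mul, Complex.cos_neg,
        Complex.sin_neg, hc, hs]
      rw [mul_neg, mul_neg, mul_neg, mul_comm]
  have hεε : (ε : ℂ) * ε = 1 := by rcases hε with rfl | rfl <;> norm_num
  have hε0 : (ε : ℂ) ≠ 0 := left_ne_zero_of_mul_eq_one hεε
  have hεI : -(ε * Complex.I) * Complex.I = ε := by
    rw [neg_mul, mul_assoc, Complex.I_mul_I]; ring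
  refine ⟨zPhase_mem_unitary _, fun a => ?_⟩
  rw [h]
  cases a
  · exact ⟨I, 1, one_ne_zero, by simp [mat]⟩
  · refine ⟨Y, ε, hε0, ?_⟩
    rw [smul_mul_assoc, mul_smul_comm, smul_comm (ε : ℂ)]
    simp only [mat, add_mul, mul_add, one_mul, mul_one, smul_mul_assoc, mul_smul_comm,
      pauliZ_mul_pauliX, pauliY_mul_pauliZ, smul_smul, hεI]
    simp only [smul_add, smul_smul]
    rw [mul_assoc, hεε, mul_one, add_comm]
  · refine ⟨X, -ε, neg_ne_zero.2 hε0, ?_⟩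
    rw [smul_mul_assoc, mul_smul_comm, smul_comm (-ε : ℂ)]
    simp only [mat, add_mul, mul_add, one_mul, mul_one, smul_mul_assoc, mul_smul_comm,
      pauliZ_mul_pauliY, pauliX_mul_pauliZ', smul_smul, mul_neg, hεI]
    simp only [smul_add, smul_smul]
    rw [neg_mul_neg, mul_assoc, hεε, mul_one, add_comm, mul_neg]
  · refine ⟨Z, 1, one_ne_zero, ?_⟩
    rw [one_smul, smul_mul_assoc, mul_smul_comm, add_mul, mul_add, smul_mul_assoc,
      mul_smul_comm, mat, one_mul, mul_one]

theorem isCliffordMat_zPhase (k : ℤ) : IsCliffordMat (zPhase (k * (Real.pi / 2))) := by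
  induction k using Int.induction_on with
  | zero => simpa [zPhase_zero] using isCliffordMat_one
  | succ k ih =>
    have := ih.mul (isCliffordMat_zPhase_of_sign (Or.inl rfl))
    rwa [← zPhase_add, ← add_mul, show ((k : ℤ) : ℝ) + 1 = ((k + 1 : ℤ) : ℝ) by push_cast; rfl]
      at this
  | pred k ih =>
    have := ih.mul (isCliffordMat_zPhase_of_sign (Or.inr rfl))
    rwa [← zPhase_add, ← add_mul,
      show ((-k : ℤ) : ℝ) + -1 = ((-k - 1 : ℤ) : ℝ) by push_cast; ring] at this

theorem isClifford_czOp {n : ℕ} {i j : Fin n} (hij : i ≠ j) : IsClifford (czOp i j) := by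
  have h01 : ∀ a : Fin 2, a = 0 ∨ a = 1 := fun a => by fin_cases a <;> simp
  refine isClifford_of_generators ?_ (fun k => ?_)
    fun k => ⟨_, isPauli_onQubit k Z, ?_⟩
  · rw [czOp_eq_mono]
    refine mono_mem_unitary (fun _ => rfl) fun y => ?_
    split_ifs <;> simp
  · by_cases hi : k = i
    · subst hi
      refine ⟨_, (isPauli_onQubit k X).mul (isPauli_onQubit j Z), ?_⟩
      simp only [mat, czOp_eq_mono, onQubit_pauliX, onQubit_pauliZ, mono_mul]
      congr 1
      funext y
      rcases h01 (y k) with h | h <;> rcases h01 (y j) with h' | h' <;>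
        simp [flipBit, zSign, h, h', hij.symm]
    · by_cases hj : k = j
      · subst hj
        refine ⟨_, (isPauli_onQubit k X).mul (isPauli_onQubit i Z), ?_⟩
        simp only [mat, czOp_eq_mono, onQubit_pauliX, onQubit_pauliZ, mono_mul]
        congr 1
        funext y
        rcases h01 (y k) with h | h <;> rcases h01 (y i) with h' | h' <;>
          simp [flipBit, zSign, h, h', hij]
      · refine ⟨_, isPauli_onQubit k X, ?_⟩
        simp only [mat, czOp_eq_mono, onQubit_pauliX, mono_mul]
        congr 1
        funext y
        simp [flipBit, Ne.symm hi, Ne.symm hj]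
  · simp only [mat, czOp_eq_mono, onQubit_pauliZ, mono_mul, mul_comm]

/-- Conjugation sends `X_c` to `X_c X_t` and `Z_t` to `Z_c Z_t`, and leaves the other generators
unchanged. -/
theorem isClifford_cnotOp {n : ℕ} {c t : Fin n} (hct : c ≠ t) : IsClifford (cnotOp c t) := by
  have h01 : ∀ a : Fin 2, a = 0 ∨ a = 1 := fun a => by fin_cases a <;> simp
  have h2 : (1 : Fin 2) + 1 = 0 := rfl
  refine isClifford_of_generators ?_ (fun k => ?_) (fun k => ?_)
  · rw [cnotOp_eq_mono]
    refine mono_mem_unitary (fun y => ?_) fun y => by simp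
    funext j
    by_cases hj : j = t
    · subst hj
      rcases h01 (y j) with h | h <;> rcases h01 (y c) with h' | h' <;>
        simp [h, h', hct, h2]
    · simp [hj]
  · by_cases hc : k = c
    · subst hc
      refine ⟨_, (isPauli_onQubit k X).mul (isPauli_onQubit t X), ?_⟩
      simp only [mat, cnotOp_eq_mono, onQubit_pauliX, mono_mul, mul_one]
      congr 1
      funext y j
      by_cases hj : j = t
      · subst hj
        rcases h01 (y j) with h | h <;> rcases h01 (y k) with h' | h' <;>
          simp [flipBit, h, h', hct, hct.symm, h2]
      · by_cases hk : j = k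
        · subst hk; simp [flipBit, hj]
        · simp [flipBit, hj, hk]
    · refine ⟨_, isPauli_onQubit k X, ?_⟩
      simp only [mat, cnotOp_eq_mono, onQubit_pauliX, mono_mul, mul_one]
      congr 1
      funext y j
      by_cases hj : j = t
      · subst hj
        by_cases hk : j = k
        · subst hk
          rcases h01 (y j) with h | h <;> rcases h01 (y c) with h' | h' <;>
            simp [flipBit, h, h', hct, h2]
        · simp [flipBit, hk, Ne.symm hc]
      · by_cases hk : j = k
        · subst hk; simp [flipBit, hj]
        · simp [flipBit, hj, hk]
  · by_cases ht : k = t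
    · subst ht
      refine ⟨_, (isPauli_onQubit c Z).mul (isPauli_onQubit k Z), ?_⟩
      simp only [mat, cnotOp_eq_mono, onQubit_pauliZ, mono_mul]
      congr 1
      funext y
      rcases h01 (y k) with h | h <;> rcases h01 (y c) with h' | h' <;>
        simp [zSign, h, h', hct, h2]
    · refine ⟨_, isPauli_onQubit k Z, ?_⟩
      simp only [mat, cnotOp_eq_mono, onQubit_pauliZ, mono_mul]
      congr 1
      funext y
      simp [zSign, ht]

theorem CPGate.isClifford_toOp {n : ℕ} {g : CPGate n} (hg : ¬ g.IsNonClifford) :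
    IsClifford g.toOp := by
  cases g with
  | s i => exact isClifford_onQubit i isCliffordMat_sMatrix
  | h i => exact isClifford_onQubit i isCliffordMat_hadamard
  | cnot c t hct => exact isClifford_cnotOp hct
  | cz i j hij => exact isClifford_czOp hij
  | phase i α =>
    simp only [IsNonClifford, ne_eq, not_forall, not_not] at hg
    obtain ⟨k, rfl⟩ := hg
    exact isClifford_onQubit i (isCliffordMat_zPhase k)

theorem CPGate.toOp_mem_unitary {n : ℕ} (g : CPGate n) : g.toOp ∈ unitary (Op n) := by
  by_cases hg : g.IsNonClifford
  · cases g with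
    | phase i α =>
      refine Matrix.mem_unitaryGroup_iff'.2 ?_
      rw [toOp, star_onQubit, onQubit_mul,
        Unitary.star_mul_self_of_mem (zPhase_mem_unitary α), onQubit_one]
    | _ => exact hg.elim
  · exact (isClifford_toOp hg).1

/-- A circuit is a Clifford operator followed by one GMS gate per non-Clifford phase gate. -/
theorem exists_isImpl_mul_isClifford {n : ℕ} (c : List (CPGate n)) :
    ∃ W C : Op n, IsImpl (nonCliffordCount c) W ∧ IsClifford C ∧
      evalCircuit CPGate.toOp c = W * C := by
  classical
  induction c with
  | nil => exact ⟨1, 1, isImpl_one, isClifford_one, by simp [evalCircuit]⟩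
  | cons g c ih =>
    obtain ⟨W, C, hW, hC, h⟩ := ih
    by_cases hg : g.IsNonClifford
    · have hcount : nonCliffordCount (g :: c) = nonCliffordCount c + 1 := by
        simp [nonCliffordCount, hg]
      cases g with
      | phase i α =>
        obtain ⟨M, hM, hCM⟩ := hC.2 _ (isPauli_onQubit i Z)
        obtain ⟨q, hq⟩ := exists_not_fixesQubit hC.1 hM hCM
        obtain ⟨V, hV, hVi, hVM, -⟩ := exists_reduce_to_pauliZ hM
          (mul_self_of_conj hC.1 hCM (onQubit_mat_mul_self i Z)) hq
        -- Only `star V` is paid for; `V` itself joins the Clifford part, which is synthesized once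
        -- at the end.
        refine ⟨W * star V * onQubit q (zPhase α), V * C, ?_, hV.mul hC, ?_⟩
        · rw [hcount]
          exact (hW.mul hVi).mul (isImpl_onQubit q (zPhase_mem_unitary α))
        · have hCM' : C * onQubit i pauliZ = M * C := hCM
          have hZ : V * C * onQubit i pauliZ = onQubit q pauliZ * (V * C) := by
            rw [mul_assoc, hCM', ← mul_assoc, hVM, mul_assoc]
          have hR : V * C * onQubit i (zPhase α) = onQubit q (zPhase α) * (V * C) := by
            rw [zPhase_eq, onQubit_add, onQubit_add, onQubit_smul, onQubit_smul, onQubit_smul,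
              onQubit_smul, onQubit_one, onQubit_one, mul_add, add_mul, mul_smul_comm,
              mul_smul_comm, smul_mul_assoc, smul_mul_assoc, hZ, mul_one, one_mul]
          rw [evalCircuit, h, CPGate.toOp, mul_assoc _ (onQubit q _), ← hR, mul_assoc V,
            mul_assoc W (star V), ← mul_assoc (star V), Unitary.star_mul_self_of_mem hV.1,
            one_mul, mul_assoc]
      | _ => exact hg.elim
    · refine ⟨W, C * g.toOp, ?_, hC.mul (CPGate.isClifford_toOp hg), ?_⟩
      · have hcount : nonCliffordCount (g :: c) = nonCliffordCount c := by
          simp [nonCliffordCount, hg]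
        rwa [hcount]
      · rw [evalCircuit, h, mul_assoc]

/-- Needed for one qubit, where the whole circuit collapses to a single unitary gate. -/
theorem evalCircuit_mem_unitary {n : ℕ} (c : List (CPGate n)) :
    evalCircuit CPGate.toOp c ∈ unitary (Op n) := by
  induction c with
  | nil => exact one_mem _
  | cons g c ih => exact mul_mem ih g.toOp_mem_unitary

end GMSCircuit

/-! ### The gate count -/

theorem mainTheorem1 (n N : ℕ) (c : List (GMSCircuit.CPGate n))
    (hN : GMSCircuit.nonCliffordCount c = N) :
    ∃ d : List (GMSCircuit.GMSGate n),
      GMSCircuit.evalCircuit GMSCircuit.GMSGate.toOp d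
          = GMSCircuit.evalCircuit GMSCircuit.CPGate.toOp c ∧
        (GMSCircuit.gmsCount d : ℤ) ≤ max 0 ((N : ℤ) + 6 * (n : ℤ) - 8) := by
  open GMSCircuit in
  rcases n with _ | _ | n
  · rcases c with _ | ⟨g, c⟩
    · exact ⟨[], rfl, by simp [gmsCount]⟩
    · cases g with
      | s i => exact i.elim0
      | h i => exact i.elim0
      | cnot i => exact i.elim0
      | cz i => exact i.elim0
      | phase i => exact i.elim0
  · obtain ⟨d, hd, hk⟩ := isImpl_zero_of_fixesQubit (q := 0) (evalCircuit_mem_unitary c)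
      fun i hi => absurd (Fin.ext (by simp)) hi
    exact ⟨d, hd, by omega⟩
  -- The number of qubits is now `n + 2`, so the Clifford part costs `3 * (n + 1)`, within the
  -- allowed `6 * (n + 2) - 8`.
  · obtain ⟨W, C, hW, hC, h⟩ := exists_isImpl_mul_isClifford c
    have hC' := hC.isImpl (A := ∅) (n + 1) (by simp) (by simp)
    obtain ⟨d, hd, hk⟩ := hW.mul hC'
    exact ⟨d, hd.trans h.symm, by push_cast; omega⟩
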